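/- Let $\mathbb T^d=\mathbb R^d/\mathbb Z^d$ be the flat torus, $\mathcal P=\{\rho\in C^\infty(\mathbb T^d):\rho>0,\ \int\rho\,dx=1\}$, and $T_\rho\mathcal P=\{\sigma\in C^\infty(\mathbb T^d):\int\sigma\,dx=0\}$. Write $\Delta_a f=\nabla\cdot(a\nabla f)$. The transport (Wasserstein-2) metric is $\mathbf g(\rho)(\sigma_1,\sigma_2)=\int\sigma_1(-\Delta_\rho)^{-1}\sigma_2\,dx$, with Christoffel symbol $$\mathbf\Gamma(\rho)(\sigma_1,\sigma_2)=-\tfrac12\Big\{\Delta_{\sigma_1}\Delta_\rho^{-1}\sigma_2+\Delta_{\sigma_2}\Delta_\rho^{-1}\sigma_1+\Delta_\rho\big(\nabla\Delta_\rho^{-1}\sigma_1,\nabla\Delta_\rho^{-1}\sigma_2\big)\Big\}.$$ With $\delta,\delta^2$ the $L^2$ first and second variations, the transport Hessian metric of a functional $\mathcal E$ on $\mathcal P$ is $$\mathbf g^{\mathrm H}(\rho)(\sigma_1,\sigma_2)=\mathrm{Hess}_{\mathbf g}\mathcal E(\rho)(\sigma_1,\sigma_2)=\iint\delta^2\mathcal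 E(\rho)(x,y)\,\sigma_1(x)\sigma_2(y)\,dx\,dy-\int\delta\mathcal E(\rho)\,\mathbf\Gamma(\rho)(\sigma_1,\sigma_2)\,dx .$$ For a metric $G$ on $\mathcal P$, $\mathrm{grad}_G\mathcal F(\rho)$ denotes a tangent vector $\tau=-\nabla\cdot(\rho\nabla\Phi)\in T_\rho\mathcal P$, $\Phi\in C^\infty(\mathbb T^d)$, such that $G(\rho)(\sigma,\tau)=\int\delta\mathcal F(\rho)\,\sigma\,dx$ for all $\sigma\in T_\rho\mathcal P$; a gradient flow of $\mathcal F$ in $(\mathcal P,G)$ is a curve in $\mathcal P$ with $\partial_t\rho=-\mathrm{grad}_G\mathcal F(\rho)$. Take $\mathcal E(\rho)=\int\rho\log\rho\,dx$ and $\mathcal F(\rho)=\tfrac12\int\|\nabla\log\rho\|^2\rho\,dx$ (half the Fisher information), and let $\mathbf g^{\mathrm H}$ be the transport Hessian metric of $\mathcal E$. Then for every $\rho\in\mathcal P$: 1. $\mathrm{grad}_{\mathbf g}\mathcal E(\rho)$ exists, is unique, and equals $-\Delta\rho$, and $\mathcal F(\rho)=\tfrac12\,\mathbf g(\rho)\big(\mathrm{grad}_{\mathbf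 g}\mathcal E(\rho),\mathrm{grad}_{\mathbf g}\mathcal E(\rho)\big)$; 2. $\mathbf g^{\mathrm H}(\rho)$ is positive definite on $T_\rho\mathcal P$; 3. $\mathrm{grad}_{\mathbf g^{\mathrm H}}\mathcal F(\rho)$ exists, is unique, and equals $-\Delta\rho$. Consequently the transport Hessian gradient flow of $\mathcal F$ is the heat equation: a curve $t\mapsto\rho(t,\cdot)\in\mathcal P$, $t\in I\subseteq\mathbb R$, satisfies $\partial_t\rho=-\mathrm{grad}_{\mathbf g^{\mathrm H}}\mathcal F(\rho)$ on $I$ if and only if $\partial_t\rho=\Delta\rho$ on $I$. -/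

import Mathlib

open MeasureTheory Set
open scoped ContDiff

noncomputable section

namespace TransportHessian

/-- A real function on the flat torus `𝕋^d = ℝ^d / ℤ^d` is a `ℤ^d`-periodic function on `ℝ^d`.
This is the predicate `f ∈ C^∞(𝕋^d)`. -/
structure IsTorusSmooth {d : ℕ} (f : (Fin d → ℝ) → ℝ) : Prop where
  contDiff : ContDiff ℝ ∞ f
  periodic : ∀ (x : Fin d → ℝ) (k : Fin d → ℤ), f (x + fun i => (k i : ℝ)) = f x

/-- The integral over the torus, computed on the fundamental cell `[0,1]^d`. -/
def torusIntegral {d : ℕ} (f : (Fin d → ℝ) → ℝ) : ℝ :=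
  ∫ x in Icc (0 : Fin d → ℝ) 1, f x

/-- The partial derivative `∂_i f`. -/
def pd {d : ℕ} (i : Fin d) (f : (Fin d → ℝ) → ℝ) (x : Fin d → ℝ) : ℝ :=
  fderiv ℝ f x (Pi.single i 1)

/-- The Euclidean inner product of gradients `(∇f, ∇g)`. -/
def gradInner {d : ℕ} (f g : (Fin d → ℝ) → ℝ) (x : Fin d → ℝ) : ℝ :=
  ∑ i, pd i f x * pd i g x

/-- The Laplacian `Δf`. -/
def laplacian {d : ℕ} (f : (Fin d → ℝ) → ℝ) (x : Fin d → ℝ) : ℝ :=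
  ∑ i, pd i (pd i f) x

/-- The weighted Laplacian `Δ_a f = ∇·(a∇f)`. -/
def wLap {d : ℕ} (a f : (Fin d → ℝ) → ℝ) (x : Fin d → ℝ) : ℝ :=
  ∑ i, pd i (fun y => a y * pd i f y) x

/-- The space `𝒫` of smooth positive probability densities on the torus. -/
def densities (d : ℕ) : Set ((Fin d → ℝ) → ℝ) :=
  {ρ | IsTorusSmooth ρ ∧ torusIntegral ρ = 1 ∧ ∀ x, 0 < ρ x}

/-- The tangent space `T_ρ𝒫` (the same set of functions at every `ρ`): smooth functions of
zero mean. -/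
def tangent (d : ℕ) : Set ((Fin d → ℝ) → ℝ) :=
  {σ | IsTorusSmooth σ ∧ torusIntegral σ = 0}

open Classical in
/-- The inverse `Δ_ρ⁻¹ σ`: a smooth function `Φ` with `∇·(ρ∇Φ) = σ`. For `ρ ∈ 𝒫` and
`σ ∈ T_ρ𝒫` such a `Φ` exists and is unique up to an additive constant, which affects none of the
quantities below; outside that range the value is `0`. -/
def invWLap {d : ℕ} (ρ σ : (Fin d → ℝ) → ℝ) : (Fin d → ℝ) → ℝ :=
  if h : ∃ Φ, IsTorusSmooth Φ ∧ wLap ρ Φ = σ then h.choose else 0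

/-- The transport (Wasserstein-2) metric `g(ρ)(σ₁, σ₂) = ∫ σ₁ (-Δ_ρ)⁻¹ σ₂`. -/
def transportMetric {d : ℕ} (ρ σ₁ σ₂ : (Fin d → ℝ) → ℝ) : ℝ :=
  torusIntegral fun x => σ₁ x * (-invWLap ρ σ₂ x)

/-- The Christoffel symbol (Levi-Civita connection) `Γ(ρ)(σ₁, σ₂)` of the transport metric. -/
def christoffel {d : ℕ} (ρ σ₁ σ₂ : (Fin d → ℝ) → ℝ) (x : Fin d → ℝ) : ℝ :=
  -(1 / 2) * (wLap σ₁ (invWLap ρ σ₂) x + wLap σ₂ (invWLap ρ σ₁) x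
    + wLap ρ (gradInner (invWLap ρ σ₁) (invWLap ρ σ₂)) x)

/-- `f = δE(ρ)`: the smooth function `f` is an `L²` first variation of the functional `E` at `ρ`,
that is, `d/ds E(ρ + sσ) = ∫ f σ` at `s = 0` for all tangent vectors `σ`. -/
def IsFirstVariation {d : ℕ} (E : ((Fin d → ℝ) → ℝ) → ℝ) (ρ f : (Fin d → ℝ) → ℝ) : Prop :=
  IsTorusSmooth f ∧ ∀ σ ∈ tangent d,
    HasDerivAt (fun s : ℝ => E (ρ + s • σ)) (torusIntegral fun x => f x * σ x) 0

open Classical in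
/-- The first variation `δE(ρ)`, determined up to an additive constant. -/
def firstVariation {d : ℕ} (E : ((Fin d → ℝ) → ℝ) → ℝ) (ρ : (Fin d → ℝ) → ℝ) :
    (Fin d → ℝ) → ℝ :=
  if h : ∃ f, IsFirstVariation E ρ f then h.choose else 0

/-- The second variation as a bilinear form, `∬ δ²E(ρ)(x,y) σ₁(x) σ₂(y) dx dy`, i.e. the mixed
derivative `∂_t ∂_s E(ρ + sσ₁ + tσ₂)` at `s = t = 0`. -/
def secondVariation {d : ℕ} (E : ((Fin d → ℝ) → ℝ) → ℝ) (ρ σ₁ σ₂ : (Fin d → ℝ) → ℝ) : ℝ :=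
  deriv (fun t : ℝ => deriv (fun s : ℝ => E (ρ + s • σ₁ + t • σ₂)) 0) 0

/-- The transport Hessian metric `g^H(ρ)(σ₁, σ₂) = Hess_g E(ρ)(σ₁, σ₂)` of the energy `E`: the
Riemannian Hessian of `E` for the transport metric. -/
def hessianMetric {d : ℕ} (E : ((Fin d → ℝ) → ℝ) → ℝ) (ρ σ₁ σ₂ : (Fin d → ℝ) → ℝ) : ℝ :=
  secondVariation E ρ σ₁ σ₂
    - torusIntegral fun x => firstVariation E ρ x * christoffel ρ σ₁ σ₂ x

/-- `τ = grad_G F(ρ)` for a metric `G` on `𝒫`: `τ = -∇·(ρ∇Φ)` is the tangent vector at `ρ` of some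
potential `Φ ∈ C^∞(𝕋^d)`, `F` has a first variation at `ρ`, and `G(ρ)(σ, τ) = ∫ δF(ρ) σ` for all
`σ ∈ T_ρ𝒫`. -/
def IsGradient {d : ℕ}
    (G : ((Fin d → ℝ) → ℝ) → ((Fin d → ℝ) → ℝ) → ((Fin d → ℝ) → ℝ) → ℝ)
    (F : ((Fin d → ℝ) → ℝ) → ℝ) (ρ τ : (Fin d → ℝ) → ℝ) : Prop :=
  τ ∈ tangent d ∧ (∃ Φ, IsTorusSmooth Φ ∧ τ = -wLap ρ Φ) ∧
    ∃ f, IsFirstVariation F ρ f ∧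
      ∀ σ ∈ tangent d, G ρ σ τ = torusIntegral fun x => f x * σ x

/-- `t ↦ ρ(t, ·)`, `t ∈ I`, is a gradient flow `∂_t ρ = -grad_G F(ρ)` in `(𝒫, G)`. -/
def IsGradientFlow {d : ℕ}
    (G : ((Fin d → ℝ) → ℝ) → ((Fin d → ℝ) → ℝ) → ((Fin d → ℝ) → ℝ) → ℝ)
    (F : ((Fin d → ℝ) → ℝ) → ℝ) (I : Set ℝ) (ρ : ℝ → (Fin d → ℝ) → ℝ) : Prop :=
  ∀ t ∈ I, ρ t ∈ densities d ∧
    ∃ τ, IsGradient G F (ρ t) τ ∧ ∀ x, HasDerivWithinAt (fun s => ρ s x) (-τ x) I t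

/-- The negative Boltzmann-Shannon entropy `∫ ρ log ρ`. -/
def entropy {d : ℕ} (ρ : (Fin d → ℝ) → ℝ) : ℝ :=
  torusIntegral fun x => ρ x * Real.log (ρ x)

/-- Half of the Fisher information, `½ ∫ ‖∇ log ρ‖² ρ`. -/
def halfFisher {d : ℕ} (ρ : (Fin d → ℝ) → ℝ) : ℝ :=
  1 / 2 * torusIntegral fun x =>
    gradInner (fun y => Real.log (ρ y)) (fun y => Real.log (ρ y)) x * ρ x

end TransportHessian

end

open TransportHessian

/-! Everything is written in potentials. If every tangent vector is σ = ∇·(ρ∇Φ), both metrics become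
integrals over the torus. Integration by parts against log ρ turns the Hessian metric of the entropy
into the explicit bilinear form `hessianIntegrand` (`hessianMetric_wLap`), and Bochner's formula
reduces its diagonal to ∫ρ|D²Φ|² (`hessianMetric_wLap_self`). If that vanishes, each ∂ᵢΦ is
constant; a derivative of a periodic function has mean zero, so the constant is 0 and σ = 0. This is
positive definiteness.

For the gradient, -Δρ has potential -log ρ. Inserting it makes the cross terms of the bilinear form
cancel, leaving pointwise σ·(-Δ log ρ - ½|∇ log ρ|²), which is σ times the first variation of half
the Fisher information. Uniqueness follows from definiteness, by testing against the difference of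
two candidates. The flow statement is then a substitution.

The analytic input is solvability of ∇·(ρ∇Φ) = σ (`exists_wLap_eq`), proved with Fourier series.
After division by |k| and |l| the operator has matrix ρ̂(k-l) times the cosine of the angle between
k and l. It is bounded on ℓ² by Schur's test and coercive with constant min ρ, because Toeplitz
forms are ρ-weighted L² norms. Conjugation by slowly varying weights (1+t²|k|²)^N preserves
coercivity for small t, so the solution decays rapidly and its Fourier series is smooth
(`exists_rapidDecay_solution`). -/

namespace TransportHessian

/-! ### Calculus and integration by parts for periodic functions. -/

section Calculus

variable {d : ℕ} {f g a : (Fin d → ℝ) → ℝ}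

namespace IsTorusSmooth

lemma continuous (hf : IsTorusSmooth f) : Continuous f := hf.contDiff.continuous

lemma differentiable (hf : IsTorusSmooth f) : Differentiable ℝ f :=
  hf.contDiff.differentiable (by simp)

lemma const (c : ℝ) : IsTorusSmooth (fun _ : Fin d → ℝ => c) := ⟨contDiff_const, fun _ _ => rfl⟩

lemma add (hf : IsTorusSmooth f) (hg : IsTorusSmooth g) : IsTorusSmooth (fun x => f x + g x) :=
  ⟨hf.contDiff.add hg.contDiff, fun x k => by rw [hf.periodic, hg.periodic]⟩

lemma sub (hf : IsTorusSmooth f) (hg : IsTorusSmooth g) : IsTorusSmooth (fun x => f x - g x) :=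
  ⟨hf.contDiff.sub hg.contDiff, fun x k => by rw [hf.periodic, hg.periodic]⟩

lemma mul (hf : IsTorusSmooth f) (hg : IsTorusSmooth g) : IsTorusSmooth (fun x => f x * g x) :=
  ⟨hf.contDiff.mul hg.contDiff, fun x k => by rw [hf.periodic, hg.periodic]⟩

lemma neg (hf : IsTorusSmooth f) : IsTorusSmooth (fun x => -f x) :=
  ⟨hf.contDiff.neg, fun x k => by rw [hf.periodic]⟩

lemma const_mul (hf : IsTorusSmooth f) (c : ℝ) : IsTorusSmooth (fun x => c * f x) :=
  (const c).mul hf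

lemma sum {ι : Type*} {s : Finset ι} {F : ι → (Fin d → ℝ) → ℝ}
    (hF : ∀ i ∈ s, IsTorusSmooth (F i)) : IsTorusSmooth (fun x => ∑ i ∈ s, F i x) :=
  ⟨ContDiff.sum fun i hi => (hF i hi).contDiff,
    fun x k => Finset.sum_congr rfl fun i hi => (hF i hi).periodic x k⟩

lemma div (hf : IsTorusSmooth f) (hg : IsTorusSmooth g) (h : ∀ x, g x ≠ 0) :
    IsTorusSmooth (fun x => f x / g x) :=
  ⟨hf.contDiff.div hg.contDiff h, fun x k => by rw [hf.periodic, hg.periodic]⟩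

lemma log (hf : IsTorusSmooth f) (h : ∀ x, f x ≠ 0) : IsTorusSmooth (fun x => Real.log (f x)) :=
  ⟨hf.contDiff.log h, fun x k => by rw [hf.periodic]⟩

lemma pd (hf : IsTorusSmooth f) (i : Fin d) : IsTorusSmooth (pd i f) := by
  refine ⟨(hf.contDiff.fderiv_right (m := ∞) (by simp)).clm_apply contDiff_const, fun x k => ?_⟩
  have h : (fun y => f (y + fun i => (k i : ℝ))) = f := funext fun y => hf.periodic y k
  simp only [TransportHessian.pd]
  rw [← fderiv_comp_add_right, h]

lemma gradInner (hf : IsTorusSmooth f) (hg : IsTorusSmooth g) : IsTorusSmooth (gradInner f g) :=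
  sum fun i _ => (hf.pd i).mul (hg.pd i)

lemma wLap (ha : IsTorusSmooth a) (hf : IsTorusSmooth f) : IsTorusSmooth (wLap a f) :=
  sum fun i _ => (ha.mul (hf.pd i)).pd i

lemma laplacian (hf : IsTorusSmooth f) : IsTorusSmooth (laplacian f) :=
  sum fun i _ => (hf.pd i).pd i

lemma integrableOn (hf : IsTorusSmooth f) : IntegrableOn f (Icc 0 1) :=
  hf.continuous.continuousOn.integrableOn_compact isCompact_Icc

end IsTorusSmooth

lemma pd_const (i : Fin d) (c : ℝ) (x : Fin d → ℝ) : pd i (fun _ => c) x = 0 := by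
  simp [pd]

lemma pd_add (hf : IsTorusSmooth f) (hg : IsTorusSmooth g) (i : Fin d) (x : Fin d → ℝ) :
    pd i (fun y => f y + g y) x = pd i f x + pd i g x := by
  simp [pd, fderiv_fun_add (hf.differentiable x) (hg.differentiable x)]

lemma pd_sub (hf : IsTorusSmooth f) (hg : IsTorusSmooth g) (i : Fin d) (x : Fin d → ℝ) :
    pd i (fun y => f y - g y) x = pd i f x - pd i g x := by
  simp [pd, fderiv_fun_sub (hf.differentiable x) (hg.differentiable x)]

lemma pd_neg (f : (Fin d → ℝ) → ℝ) (i : Fin d) (x : Fin d → ℝ) :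
    pd i (fun y => -f y) x = -pd i f x := by
  simp [pd, fderiv_fun_neg]

lemma pd_mul (hf : IsTorusSmooth f) (hg : IsTorusSmooth g) (i : Fin d) (x : Fin d → ℝ) :
    pd i (fun y => f y * g y) x = f x * pd i g x + g x * pd i f x := by
  simp [pd, fderiv_fun_mul (hf.differentiable x) (hg.differentiable x)]

lemma pd_const_mul (hf : IsTorusSmooth f) (c : ℝ) (i : Fin d) (x : Fin d → ℝ) :
    pd i (fun y => c * f y) x = c * pd i f x := by
  rw [pd_mul (.const c) hf, pd_const, mul_zero, add_zero]

lemma pd_sum {ι : Type*} {s : Finset ι} {F : ι → (Fin d → ℝ) → ℝ}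
    (hF : ∀ j ∈ s, IsTorusSmooth (F j)) (i : Fin d) (x : Fin d → ℝ) :
    pd i (fun y => ∑ j ∈ s, F j y) x = ∑ j ∈ s, pd i (F j) x := by
  simp [pd, fderiv_fun_sum fun j hj => (hF j hj).differentiable x]

lemma pd_log (hf : IsTorusSmooth f) (h : ∀ x, f x ≠ 0) (i : Fin d) (x : Fin d → ℝ) :
    pd i (fun y => Real.log (f y)) x = pd i f x / f x := by
  simp [pd, fderiv.log (hf.differentiable x) (h x), div_eq_inv_mul]

lemma pd_comm (hf : IsTorusSmooth f) (i j : Fin d) (x : Fin d → ℝ) :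
    pd i (pd j f) x = pd j (pd i f) x := by
  have hsymm : IsSymmSndFDerivAt ℝ f x := hf.contDiff.contDiffAt.isSymmSndFDerivAt (by
    simpa using (WithTop.coe_le_coe.2 le_top : ((2 : ℕ∞) : WithTop ℕ∞) ≤ ∞))
  have hd : DifferentiableAt ℝ (fderiv ℝ f) x :=
    (hf.contDiff.fderiv_right (m := ∞) (by simp)).differentiable (by simp) x
  have key (k l : Fin d) : pd k (pd l f) x
      = fderiv ℝ (fderiv ℝ f) x (Pi.single k 1) (Pi.single l 1) := by
    change fderiv ℝ (fun y => fderiv ℝ f y (Pi.single l 1)) x (Pi.single k 1) = _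
    rw [fderiv_clm_apply hd (differentiableAt_const _)]
    simp
  rw [key, key, hsymm]

/-- The integral of a partial derivative of a `ℤ^d`-periodic `C¹` function over the unit cell
vanishes. -/
lemma setIntegral_fderiv_single_eq_zero {E : Type*} [NormedAddCommGroup E] [NormedSpace ℝ E]
    [CompleteSpace E] {F : (Fin d → ℝ) → E} (hF : ContDiff ℝ 1 F)
    (hper : ∀ (x : Fin d → ℝ) (k : Fin d → ℤ), F (x + fun i => (k i : ℝ)) = F x) (i : Fin d) :
    ∫ x in Icc (0 : Fin d → ℝ) 1, fderiv ℝ F x (Pi.single i 1) = 0 := by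
  obtain _ | n := d
  · exact i.elim0
  have hd : ∀ x, HasFDerivAt F (fderiv ℝ F x) x :=
    fun x => (hF.differentiable (by simp) x).hasFDerivAt
  have hc : Continuous fun x => fderiv ℝ F x (Pi.single i 1) :=
    (hF.continuous_fderiv (by simp)).clm_apply continuous_const
  -- Divergence theorem for the vector field whose only nonzero component is the `i`-th.
  have key := integral_divergence_of_hasFDerivAt_off_countable' (0 : Fin (n + 1) → ℝ) 1
    zero_le_one (fun j => if j = i then F else 0) (fun j => if j = i then fderiv ℝ F else 0) ∅
    countable_empty
    (fun j => by
      by_cases h : j = i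
      · simpa [h] using hF.continuous.continuousOn
      · simp only [h, if_false]
        exact continuousOn_const)
    (fun x _ j => by
      by_cases h : j = i
      · simpa [h] using hd x
      · simp only [h, if_false]
        exact hasFDerivAt_const (0 : E) x)
    (by
      refine (hc.continuousOn.integrableOn_compact isCompact_Icc).congr_fun (fun x _ => ?_)
        measurableSet_Icc
      simp only
      rw [Finset.sum_eq_single i (by intro j _ h; simp [h]) (by simp)]
      simp)
  have h1 : ∀ x, ∑ j, (if j = i then fderiv ℝ F else 0) x (Pi.single j 1)
      = fderiv ℝ F x (Pi.single i 1) := fun x => by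
    rw [Finset.sum_eq_single i (by intro j _ h; simp [h]) (by simp)]
    simp
  simp only [h1] at key
  rw [key]
  refine Finset.sum_eq_zero fun j _ => ?_
  by_cases h : j = i
  · subst h
    rw [sub_eq_zero]
    refine integral_congr_ae (Filter.Eventually.of_forall fun y => ?_)
    -- Opposite faces differ by a lattice vector, so periodicity cancels the boundary terms.
    have : j.insertNth ((1 : Fin (n + 1) → ℝ) j) y
        = j.insertNth ((0 : Fin (n + 1) → ℝ) j) y
          + fun l => (((Pi.single j 1 : Fin (n + 1) → ℤ) l : ℤ) : ℝ) := by
      ext l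
      refine Fin.succAboveCases j ?_ (fun l => ?_) l <;> simp
    simp only [if_true]
    rw [this, hper]
  · simp [h]

lemma torusIntegral_pd (hf : IsTorusSmooth f) (i : Fin d) : torusIntegral (pd i f) = 0 :=
  setIntegral_fderiv_single_eq_zero (hf.contDiff.of_le (by simp)) hf.periodic i

lemma torusIntegral_add (hf : IsTorusSmooth f) (hg : IsTorusSmooth g) :
    torusIntegral (fun x => f x + g x) = torusIntegral f + torusIntegral g :=
  integral_add hf.integrableOn hg.integrableOn

lemma torusIntegral_sub (hf : IsTorusSmooth f) (hg : IsTorusSmooth g) :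
    torusIntegral (fun x => f x - g x) = torusIntegral f - torusIntegral g :=
  integral_sub hf.integrableOn hg.integrableOn

lemma torusIntegral_neg (f : (Fin d → ℝ) → ℝ) :
    torusIntegral (fun x => -f x) = -torusIntegral f :=
  integral_neg f

lemma torusIntegral_const_mul (c : ℝ) (f : (Fin d → ℝ) → ℝ) :
    torusIntegral (fun x => c * f x) = c * torusIntegral f :=
  integral_const_mul c f

lemma torusIntegral_sum {ι : Type*} {s : Finset ι} {F : ι → (Fin d → ℝ) → ℝ}
    (hF : ∀ i ∈ s, IsTorusSmooth (F i)) :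
    torusIntegral (fun x => ∑ i ∈ s, F i x) = ∑ i ∈ s, torusIntegral (F i) :=
  integral_finsetSum s fun i hi => (hF i hi).integrableOn

lemma volume_cell : volume.real (Icc (0 : Fin d → ℝ) 1) = 1 := by
  simp [Measure.real, Real.volume_Icc_pi]

lemma torusIntegral_const (c : ℝ) : torusIntegral (fun _ : Fin d → ℝ => c) = c := by
  simp [torusIntegral, volume_cell]

lemma torusIntegral_mul_pd (hf : IsTorusSmooth f) (hg : IsTorusSmooth g) (i : Fin d) :
    torusIntegral (fun x => f x * pd i g x) = -torusIntegral (fun x => pd i f x * g x) := by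
  have h := torusIntegral_pd (hf.mul hg) i
  rw [funext (pd_mul hf hg i), torusIntegral_add (hf.mul (hg.pd i)) (hg.mul (hf.pd i))] at h
  simp only [mul_comm (pd i f _)]
  linarith

lemma torusIntegral_mul_wLap (hf : IsTorusSmooth f) (ha : IsTorusSmooth a)
    (hg : IsTorusSmooth g) :
    torusIntegral (fun x => f x * wLap a g x)
      = -torusIntegral (fun x => a x * gradInner f g x) := by
  simp only [wLap, gradInner, Finset.mul_sum]
  rw [torusIntegral_sum fun i _ => hf.mul ((ha.mul (hg.pd i)).pd i),
    torusIntegral_sum fun i _ => ha.mul ((hf.pd i).mul (hg.pd i)), ← Finset.sum_neg_distrib]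
  refine Finset.sum_congr rfl fun i _ => ?_
  rw [torusIntegral_mul_pd hf (ha.mul (hg.pd i))]
  simp only [mul_left_comm (pd i f _)]

lemma gradInner_comm (f g : (Fin d → ℝ) → ℝ) : gradInner f g = gradInner g f := by
  ext x; simp [gradInner, mul_comm]

lemma torusIntegral_mul_wLap_comm (hf : IsTorusSmooth f) (ha : IsTorusSmooth a)
    (hg : IsTorusSmooth g) :
    torusIntegral (fun x => f x * wLap a g x) = torusIntegral (fun x => g x * wLap a f x) := by
  rw [torusIntegral_mul_wLap hf ha hg, torusIntegral_mul_wLap hg ha hf, gradInner_comm]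

lemma torusIntegral_wLap (ha : IsTorusSmooth a) (hg : IsTorusSmooth g) :
    torusIntegral (wLap a g) = 0 := by
  have := torusIntegral_mul_wLap (IsTorusSmooth.const 1) ha hg
  simpa [gradInner, pd_const, torusIntegral_const] using this

lemma wLap_one (f : (Fin d → ℝ) → ℝ) : wLap (fun _ => 1) f = laplacian f := by
  ext x; simp [wLap, laplacian]

lemma wLap_mem_tangent (ha : IsTorusSmooth a) (hg : IsTorusSmooth g) : wLap a g ∈ tangent d :=
  ⟨ha.wLap hg, torusIntegral_wLap ha hg⟩

lemma laplacian_mem_tangent (hf : IsTorusSmooth f) : laplacian f ∈ tangent d := by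
  rw [← wLap_one]; exact wLap_mem_tangent (.const 1) hf

lemma neg_mem_tangent (hf : f ∈ tangent d) : -f ∈ tangent d :=
  ⟨hf.1.neg, (torusIntegral_neg f).trans (by rw [hf.2, neg_zero])⟩

lemma wLap_expand (ha : IsTorusSmooth a) (hf : IsTorusSmooth f) (x : Fin d → ℝ) :
    wLap a f x = a x * laplacian f x + gradInner a f x := by
  simp only [wLap, laplacian, gradInner, Finset.mul_sum, ← Finset.sum_add_distrib]
  refine Finset.sum_congr rfl fun i _ => ?_
  rw [pd_mul ha (hf.pd i)]
  ring

lemma wLap_neg (a f : (Fin d → ℝ) → ℝ) : wLap a (fun x => -f x) = -wLap a f := by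
  ext x
  simp only [wLap, mul_neg, pd_neg, Finset.sum_neg_distrib, Pi.neg_apply]

lemma wLap_add (ha : IsTorusSmooth a) (hf : IsTorusSmooth f) (hg : IsTorusSmooth g) :
    wLap a (fun x => f x + g x) = wLap a f + wLap a g := by
  ext x
  simp only [wLap, Pi.add_apply, ← Finset.sum_add_distrib]
  refine Finset.sum_congr rfl fun i _ => ?_
  rw [← pd_add (ha.mul (hf.pd i)) (ha.mul (hg.pd i))]
  congr 1
  ext y
  rw [pd_add hf hg, mul_add]

lemma wLap_sub (ha : IsTorusSmooth a) (hf : IsTorusSmooth f) (hg : IsTorusSmooth g) :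
    wLap a (fun x => f x - g x) = wLap a f - wLap a g := by
  simp only [sub_eq_add_neg]
  rw [wLap_add ha hf hg.neg, wLap_neg]

end Calculus

/-! ### Uniqueness of first variations and of potentials, up to constants. -/

section Uniqueness

variable {d : ℕ} {f g ρ : (Fin d → ℝ) → ℝ}

lemma exists_int_add_mem_cell (x : Fin d → ℝ) :
    ∃ k : Fin d → ℤ, x + (fun i => (k i : ℝ)) ∈ Icc (0 : Fin d → ℝ) 1 := by
  refine ⟨fun i => -⌊x i⌋, fun i => ?_, fun i => ?_⟩
  · simpa using Int.floor_le (x i)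
  · simpa [add_comm] using (Int.lt_floor_add_one (x i)).le

/-- Allows an almost everywhere identity between continuous functions on the closed cell to hold at
every point, faces included. -/
lemma cell_subset_closure_interior :
    Icc (0 : Fin d → ℝ) 1 ⊆ closure (interior (Icc (0 : Fin d → ℝ) 1)) := by
  have hne : (interior (Icc (0 : Fin d → ℝ) 1)).Nonempty := by
    refine ⟨fun _ => 1 / 2, ?_⟩
    rw [← pi_univ_Icc, interior_pi_set finite_univ]
    intro i _
    simp only [Pi.zero_apply, Pi.one_apply, interior_Icc, mem_Ioo]
    norm_num
  rw [(convex_Icc (𝕜 := ℝ) (0 : Fin d → ℝ) 1).closure_interior_eq_closure_of_nonempty_interior hne]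
  exact subset_closure

/-- A nonnegative continuous periodic function of zero integral vanishes. -/
lemma eq_zero_of_setIntegral_cell_eq_zero (hf : Continuous f)
    (hper : ∀ (x : Fin d → ℝ) (k : Fin d → ℤ), f (x + fun i => (k i : ℝ)) = f x)
    (h0 : ∀ x, 0 ≤ f x) (h : torusIntegral f = 0) (x : Fin d → ℝ) : f x = 0 := by
  have hae := (setIntegral_eq_zero_iff_of_nonneg_ae (Filter.Eventually.of_forall h0)
    (hf.continuousOn.integrableOn_compact isCompact_Icc)).1 h
  have heq := Measure.eqOn_of_ae_eq hae hf.continuousOn continuousOn_const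
    cell_subset_closure_interior
  obtain ⟨k, hk⟩ := exists_int_add_mem_cell x
  rw [← hper x k]
  exact heq hk

lemma IsTorusSmooth.eq_zero (hf : IsTorusSmooth f) (h0 : ∀ x, 0 ≤ f x)
    (h : torusIntegral f = 0) (x : Fin d → ℝ) : f x = 0 :=
  eq_zero_of_setIntegral_cell_eq_zero hf.continuous hf.periodic h0 h x

/-- Two smooth functions with the same pairings with tangent vectors differ by a constant. -/
lemma exists_eq_add_const (hf : IsTorusSmooth f) (hg : IsTorusSmooth g)
    (h : ∀ σ ∈ tangent d, torusIntegral (fun x => f x * σ x) = torusIntegral (fun x => g x * σ x)) :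
    ∃ c : ℝ, f = fun x => g x + c := by
  set c := torusIntegral fun x => f x - g x with hc
  have hs : IsTorusSmooth fun x => (f x - g x) - c := (hf.sub hg).sub (.const c)
  have hs0 : torusIntegral (fun x => (f x - g x) - c) = 0 := by
    rw [torusIntegral_sub (hf.sub hg) (.const c), torusIntegral_const, ← hc, sub_self]
  -- The test vector is the mean-zero part of `f - g` itself, so the pairing gives its squared L²
  -- norm.
  have hσ := h _ ⟨hs, hs0⟩
  have hz : torusIntegral (fun x => ((f x - g x) - c) * ((f x - g x) - c)) = 0 := by
    have : (fun x => ((f x - g x) - c) * ((f x - g x) - c)) = fun x =>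
        (f x * ((f x - g x) - c) - g x * ((f x - g x) - c)) - c * ((f x - g x) - c) := by
      ext x; ring
    rw [this, torusIntegral_sub ((hf.mul hs).sub (hg.mul hs)) (hs.const_mul c),
      torusIntegral_sub (hf.mul hs) (hg.mul hs), hσ, torusIntegral_const_mul, hs0]
    ring
  refine ⟨c, funext fun x => ?_⟩
  have := (hs.mul hs).eq_zero (fun x => mul_self_nonneg _) hz x
  have := mul_self_eq_zero.1 this
  linarith

lemma exists_eq_const_of_pd_eq_zero (hf : IsTorusSmooth f) (h : ∀ i x, pd i f x = 0) :
    ∃ c : ℝ, f = fun _ => c := by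
  refine ⟨f 0, funext fun x => is_const_of_fderiv_eq_zero hf.differentiable (fun y => ?_) x 0⟩
  refine ContinuousLinearMap.coe_injective ((Pi.basisFun ℝ (Fin d)).ext fun i => ?_)
  simpa [pd] using h i y

/-- Energy identity: pairing the equation with `f` gives ∫ρ|∇f|² = 0, and ρ is positive. -/
lemma exists_eq_const_of_wLap_eq_zero (hρ : ρ ∈ densities d) (hf : IsTorusSmooth f)
    (h : wLap ρ f = 0) : ∃ c : ℝ, f = fun _ => c := by
  have h0 := torusIntegral_mul_wLap hf hρ.1 hf
  simp only [h, Pi.zero_apply, mul_zero, torusIntegral_const, gradInner] at h0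
  have hnn : ∀ x, 0 ≤ ∑ i, pd i f x * pd i f x :=
    fun x => Finset.sum_nonneg fun i _ => mul_self_nonneg _
  have hz := (hρ.1.mul (hf.gradInner hf)).eq_zero (fun x => mul_nonneg (hρ.2.2 x).le (hnn x))
    (by simp only [gradInner]; linarith)
  refine exists_eq_const_of_pd_eq_zero hf fun i x => ?_
  have h1 := (mul_eq_zero.1 (hz x)).resolve_left (hρ.2.2 x).ne'
  have h2 := (Finset.sum_eq_zero_iff_of_nonneg fun i _ => mul_self_nonneg _).1 h1 i
    (Finset.mem_univ i)
  exact mul_self_eq_zero.1 h2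

/-- The inverse of the weighted Laplacian, up to a constant. -/
lemma invWLap_wLap (hρ : ρ ∈ densities d) (hf : IsTorusSmooth f) :
    ∃ c : ℝ, invWLap ρ (wLap ρ f) = fun x => f x + c := by
  have hex : ∃ Φ, IsTorusSmooth Φ ∧ wLap ρ Φ = wLap ρ f := ⟨f, hf, rfl⟩
  have hspec := hex.choose_spec
  have : invWLap ρ (wLap ρ f) = hex.choose := by rw [invWLap, dif_pos hex]
  rw [this]
  obtain ⟨c, hc⟩ := exists_eq_const_of_wLap_eq_zero hρ (hspec.1.sub hf)
    (by rw [wLap_sub hρ.1 hspec.1 hf, hspec.2, sub_self])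
  exact ⟨c, funext fun x => by linarith [congrFun hc x]⟩

end Uniqueness

end TransportHessian

namespace TransportHessian

/-! ### First and second variations of the entropy and of the Fisher information. -/

section Variations

variable {d : ℕ} {f g ρ σ σ₁ σ₂ : (Fin d → ℝ) → ℝ}

lemma IsTorusSmooth.exists_abs_le (hf : IsTorusSmooth f) : ∃ M : ℝ, 0 < M ∧ ∀ x, |f x| ≤ M := by
  obtain ⟨M, hM⟩ := isCompact_Icc.exists_bound_of_continuousOn
    (s := Icc (0 : Fin d → ℝ) 1) hf.continuous.continuousOn
  refine ⟨max M 1, by positivity, fun x => ?_⟩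
  obtain ⟨k, hk⟩ := exists_int_add_mem_cell x
  rw [← hf.periodic x k]
  exact (hM _ hk).trans (le_max_left _ _)

lemma IsTorusSmooth.exists_pos_le (hf : IsTorusSmooth f) (hpos : ∀ x, 0 < f x) :
    ∃ m : ℝ, 0 < m ∧ ∀ x, m ≤ f x := by
  obtain ⟨x₀, -, h₀⟩ := isCompact_Icc.exists_isMinOn
    (nonempty_Icc.2 (zero_le_one : (0 : Fin d → ℝ) ≤ 1)) hf.continuous.continuousOn
  refine ⟨f x₀, hpos x₀, fun x => ?_⟩
  obtain ⟨k, hk⟩ := exists_int_add_mem_cell x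
  rw [← hf.periodic x k]
  exact h₀ hk

/-- Small perturbations of a positive density stay positive. -/
lemma exists_forall_pos_add (hρ : IsTorusSmooth ρ) (hpos : ∀ x, 0 < ρ x) (hσ : IsTorusSmooth σ) :
    ∃ ε : ℝ, 0 < ε ∧ ∀ s ∈ Icc (-ε) ε, ∀ x, 0 < ρ x + s * σ x := by
  obtain ⟨m, hm, hmρ⟩ := hρ.exists_pos_le hpos
  obtain ⟨M, hM, hMσ⟩ := hσ.exists_abs_le
  refine ⟨m / (2 * M), by positivity, fun s hs x => ?_⟩
  have h1 : |s * σ x| ≤ m / 2 := by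
    rw [abs_mul]
    calc |s| * |σ x| ≤ m / (2 * M) * M :=
          mul_le_mul (abs_le.2 hs) (hMσ x) (abs_nonneg _) (by positivity)
      _ = m / 2 := by field_simp
  linarith [hmρ x, neg_abs_le (s * σ x)]

/-- Differentiation under the integral over the torus. -/
lemma hasDerivAt_torusIntegral {F F' : ℝ → (Fin d → ℝ) → ℝ} {ε : ℝ} (hε : 0 < ε)
    (hF : ∀ s ∈ Icc (-ε) ε, Continuous (F s))
    (hF' : ContinuousOn (fun p : ℝ × (Fin d → ℝ) => F' p.1 p.2) (Icc (-ε) ε ×ˢ Icc 0 1))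
    (hd : ∀ s ∈ Icc (-ε) ε, ∀ x, HasDerivAt (fun s => F s x) (F' s x) s) :
    HasDerivAt (fun s => torusIntegral (F s)) (torusIntegral (F' 0)) 0 := by
  obtain ⟨M, hM⟩ := (isCompact_Icc.prod isCompact_Icc).exists_bound_of_continuousOn hF'
  have h0 : (0 : ℝ) ∈ Icc (-ε) ε := ⟨by linarith, hε.le⟩
  have hnhds : Icc (-ε) ε ∈ nhds (0 : ℝ) := Icc_mem_nhds (by linarith) hε
  have hc : ContinuousOn (F' 0) (Icc 0 1) :=
    hF'.comp (f := fun x : Fin d → ℝ => ((0 : ℝ), x)) (by fun_prop) fun x hx => ⟨h0, hx⟩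
  refine (hasDerivAt_integral_of_dominated_loc_of_deriv_le (bound := fun _ => M) hnhds ?_ ?_ ?_
    ?_ ?_ ?_).2
  · filter_upwards [hnhds] with s hs
    exact (hF s hs).aestronglyMeasurable
  · exact (hF 0 h0).continuousOn.integrableOn_compact isCompact_Icc
  · exact hc.aestronglyMeasurable measurableSet_Icc
  · filter_upwards [ae_restrict_mem measurableSet_Icc] with x hx s hs
    exact hM (s, x) ⟨hs, hx⟩
  · exact continuousOn_const.integrableOn_compact isCompact_Icc
  · exact Filter.Eventually.of_forall fun x s hs => hd s hs x

lemma hasDerivAt_add_mul (a b s : ℝ) : HasDerivAt (fun s => a + s * b) b s := by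
  simpa using ((hasDerivAt_id s).mul_const b).const_add a

lemma isFirstVariation_entropy (hρ : ρ ∈ densities d) :
    IsFirstVariation entropy ρ (fun x => Real.log (ρ x) + 1) := by
  refine ⟨(hρ.1.log fun x => (hρ.2.2 x).ne').add (.const 1), fun σ hσ => ?_⟩
  obtain ⟨ε, hε, hpos⟩ := exists_forall_pos_add hρ.1 hρ.2.2 hσ.1
  have hρc := hρ.1.continuous
  have hσc := hσ.1.continuous
  have := hasDerivAt_torusIntegral
    (F := fun s x => (ρ x + s * σ x) * Real.log (ρ x + s * σ x))
    (F' := fun s x => (Real.log (ρ x + s * σ x) + 1) * σ x) hε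
    (fun s hs => by
      have : Continuous fun x => Real.log (ρ x + s * σ x) :=
        Continuous.log (by fun_prop) fun x => (hpos s hs x).ne'
      fun_prop)
    (by
      have : ContinuousOn (fun p : ℝ × (Fin d → ℝ) => Real.log (ρ p.2 + p.1 * σ p.2))
          (Icc (-ε) ε ×ˢ Icc 0 1) :=
        ContinuousOn.log (by fun_prop) fun p hp => (hpos p.1 hp.1 p.2).ne'
      exact (this.add continuousOn_const).mul (by fun_prop))
    (fun s hs x => HasDerivAt.comp (h₂ := fun y => y * Real.log y) s
      (Real.hasDerivAt_mul_log (hpos s hs x).ne') (hasDerivAt_add_mul (ρ x) (σ x) s))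
  simpa [entropy, zero_mul, add_zero] using this

lemma secondVariation_entropy (hρ : ρ ∈ densities d) (h₁ : σ₁ ∈ tangent d) (h₂ : σ₂ ∈ tangent d) :
    secondVariation entropy ρ σ₁ σ₂ = torusIntegral fun x => σ₁ x * σ₂ x / ρ x := by
  obtain ⟨ε, hε, hpos⟩ := exists_forall_pos_add hρ.1 hρ.2.2 h₂.1
  have hρc := hρ.1.continuous
  have h₁c := h₁.1.continuous
  have h₂c := h₂.1.continuous
  -- For small `t` the function ρ + tσ₂ is again a density, so the inner derivative is the first
  -- variation there.
  have hinner : ∀ t ∈ Icc (-ε) ε, deriv (fun s : ℝ => entropy (ρ + s • σ₁ + t • σ₂)) 0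
      = torusIntegral fun x => (Real.log (ρ x + t * σ₂ x) + 1) * σ₁ x := fun t ht => by
    have hmem : (fun x => ρ x + t * σ₂ x) ∈ densities d := by
      refine ⟨hρ.1.add (h₂.1.const_mul t), ?_, hpos t ht⟩
      rw [torusIntegral_add hρ.1 (h₂.1.const_mul t), torusIntegral_const_mul, h₂.2, hρ.2.1]
      ring
    have := ((isFirstVariation_entropy hmem).2 σ₁ h₁).deriv
    rw [← this]
    congr 1
    ext s
    congr 1
    ext x
    simp only [Pi.add_apply, Pi.smul_apply, smul_eq_mul]
    ring
  have hnhds : Icc (-ε) ε ∈ nhds (0 : ℝ) := Icc_mem_nhds (by linarith) hε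
  have heq : (fun t : ℝ => deriv (fun s : ℝ => entropy (ρ + s • σ₁ + t • σ₂)) 0) =ᶠ[nhds 0]
      fun t => torusIntegral fun x => (Real.log (ρ x + t * σ₂ x) + 1) * σ₁ x := by
    filter_upwards [hnhds] with t ht using hinner t ht
  rw [secondVariation, heq.deriv_eq]
  have := hasDerivAt_torusIntegral
    (F := fun t x => (Real.log (ρ x + t * σ₂ x) + 1) * σ₁ x)
    (F' := fun t x => σ₂ x / (ρ x + t * σ₂ x) * σ₁ x) hε
    (fun s hs => by
      have : Continuous fun x => Real.log (ρ x + s * σ₂ x) :=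
        Continuous.log (by fun_prop) fun x => (hpos s hs x).ne'
      fun_prop)
    (by
      refine ContinuousOn.mul (ContinuousOn.div (by fun_prop) (by fun_prop) ?_) (by fun_prop)
      exact fun p hp => (hpos p.1 hp.1 p.2).ne')
    (fun s hs x => (((hasDerivAt_add_mul (ρ x) (σ₂ x) s).log (hpos s hs x).ne').add_const 1
      ).mul_const (σ₁ x))
  rw [this.deriv]
  congr 1
  ext x
  simp only [zero_mul, add_zero]
  ring

/-- In the form |∇ρ|²/ρ the integrand is rational in `s` along ρ + sσ, which makes it easy to
differentiate. -/
lemma halfFisher_eq (hρ : IsTorusSmooth ρ) (hpos : ∀ x, 0 < ρ x) :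
    halfFisher ρ = torusIntegral fun x => ∑ i, 1 / 2 * (pd i ρ x ^ 2 / ρ x) := by
  rw [halfFisher, ← torusIntegral_const_mul]
  congr 1
  ext x
  simp only [gradInner, pd_log hρ (fun x => (hpos x).ne'), Finset.sum_mul, Finset.mul_sum]
  refine Finset.sum_congr rfl fun i _ => ?_
  have := (hpos x).ne'
  field_simp

/-- Differentiating ½|∇ρ|²/ρ gives ∇σ·∇log ρ - ½|∇log ρ|²σ; integrating the first term by parts
moves the derivative off σ. -/
lemma isFirstVariation_halfFisher (hρ : ρ ∈ densities d) :
    IsFirstVariation halfFisher ρ (fun x => -laplacian (fun y => Real.log (ρ y)) x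
      - 1 / 2 * gradInner (fun y => Real.log (ρ y)) (fun y => Real.log (ρ y)) x) := by
  have hL := hρ.1.log fun x => (hρ.2.2 x).ne'
  refine ⟨hL.laplacian.neg.sub ((hL.gradInner hL).const_mul _), fun σ hσ => ?_⟩
  obtain ⟨ε, hε, hpos⟩ := exists_forall_pos_add hρ.1 hρ.2.2 hσ.1
  have hρc := hρ.1.continuous
  have hσc := hσ.1.continuous
  have hρi := fun i => (hρ.1.pd i).continuous
  have hσi := fun i => (hσ.1.pd i).continuous
  have hder := hasDerivAt_torusIntegral
    (F := fun s x => ∑ i, 1 / 2 * ((pd i ρ x + s * pd i σ x) ^ 2 / (ρ x + s * σ x)))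
    (F' := fun s x => ∑ i, 1 / 2 * ((2 * (pd i ρ x + s * pd i σ x) * pd i σ x * (ρ x + s * σ x)
      - (pd i ρ x + s * pd i σ x) ^ 2 * σ x) / (ρ x + s * σ x) ^ 2)) hε
    (fun s hs => by
      refine continuous_finsetSum _ fun i _ => Continuous.mul continuous_const ?_
      exact Continuous.div (by have := hρi i; have := hσi i; fun_prop) (by fun_prop)
        fun x => (hpos s hs x).ne')
    (by
      refine continuousOn_finsetSum _ fun i _ => ContinuousOn.mul continuousOn_const ?_
      refine ContinuousOn.div (by have := hρi i; have := hσi i; fun_prop) (by fun_prop) ?_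
      exact fun p hp => (pow_pos (hpos p.1 hp.1 p.2) 2).ne')
    (fun s hs x => by
      refine HasDerivAt.fun_sum fun i _ => HasDerivAt.const_mul _ ?_
      have h1 := (hasDerivAt_add_mul (pd i ρ x) (pd i σ x) s).fun_pow 2
      have h2 := h1.fun_div (hasDerivAt_add_mul (ρ x) (σ x) s) (hpos s hs x).ne'
      simpa using h2)
  have hnhds : Icc (-ε) ε ∈ nhds (0 : ℝ) := Icc_mem_nhds (by linarith) hε
  have heq : (fun s : ℝ => halfFisher (ρ + s • σ)) =ᶠ[nhds 0] fun s => torusIntegral fun x =>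
      ∑ i, 1 / 2 * ((pd i ρ x + s * pd i σ x) ^ 2 / (ρ x + s * σ x)) := by
    filter_upwards [hnhds] with s hs
    have hsm := hρ.1.add (hσ.1.const_mul s)
    have := halfFisher_eq hsm (hpos s hs)
    simp only [pd_add hρ.1 (hσ.1.const_mul s), pd_const_mul hσ.1] at this
    exact this
  refine (hder.congr_of_eventuallyEq heq).congr_deriv ?_
  have hibp := torusIntegral_mul_wLap hσ.1 (.const 1) hL
  rw [wLap_one] at hibp
  have hL2 := (hL.gradInner hL).const_mul (1 / 2)
  have hsplit : (fun x => (-laplacian (fun y => Real.log (ρ y)) x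
      - 1 / 2 * gradInner (fun y => Real.log (ρ y)) (fun y => Real.log (ρ y)) x) * σ x)
      = fun x => -(σ x * laplacian (fun y => Real.log (ρ y)) x)
        - (1 / 2 * gradInner (fun y => Real.log (ρ y)) (fun y => Real.log (ρ y)) x) * σ x := by
    ext x; ring
  rw [hsplit, torusIntegral_sub (hσ.1.mul hL.laplacian).neg (hL2.mul hσ.1), torusIntegral_neg,
    hibp, neg_neg, ← torusIntegral_sub ((IsTorusSmooth.const 1).mul (hσ.1.gradInner hL))
      (hL2.mul hσ.1)]
  congr 1
  ext x
  have hx := (hρ.2.2 x).ne'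
  simp only [gradInner, pd_log hρ.1 (fun x => (hρ.2.2 x).ne'), Finset.sum_mul, Finset.mul_sum,
    ← Finset.sum_sub_distrib, zero_mul, add_zero]
  refine Finset.sum_congr rfl fun i _ => ?_
  field_simp

lemma IsFirstVariation.exists_eq_add_const {E : ((Fin d → ℝ) → ℝ) → ℝ}
    (hf : IsFirstVariation E ρ f) (hg : IsFirstVariation E ρ g) :
    ∃ c : ℝ, f = fun x => g x + c :=
  TransportHessian.exists_eq_add_const hf.1 hg.1 fun σ hσ => (hf.2 σ hσ).unique (hg.2 σ hσ)

lemma firstVariation_entropy (hρ : ρ ∈ densities d) :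
    ∃ c : ℝ, firstVariation entropy ρ = fun x => Real.log (ρ x) + c := by
  have hex : ∃ f, IsFirstVariation entropy ρ f := ⟨_, isFirstVariation_entropy hρ⟩
  obtain ⟨c, hc⟩ := hex.choose_spec.exists_eq_add_const (isFirstVariation_entropy hρ)
  refine ⟨1 + c, ?_⟩
  rw [firstVariation, dif_pos hex, hc]
  ext x
  ring

end Variations

end TransportHessian

namespace TransportHessian

/-! ### Infinite matrices as operators on ℓ². -/

section MatrixOperators

variable {G : Type*} [AddCommGroup G]

/-- A weighted shift on `ℓ²`. -/
lemma exists_weightedShift {c : G → ℂ} {A : ℝ} (hc : ∀ k, ‖c k‖ ≤ A) (m : G) :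
    ∃ T : lp (fun _ : G => ℂ) 2 →L[ℂ] lp (fun _ : G => ℂ) 2,
      ‖T‖ ≤ A ∧ ∀ x k, T x k = c k * x (k - m) := by
  have hA : 0 ≤ A := (norm_nonneg _).trans (hc 0)
  have h2 : 0 < (2 : ENNReal).toReal := by simp
  have hbound : ∀ (x : lp (fun _ : G => ℂ) 2) (s : Finset G),
      ∑ k ∈ s, ‖c k * x (k - m)‖ ^ (2 : ENNReal).toReal ≤ (A * ‖x‖) ^ (2 : ENNReal).toReal := by
    intro x s
    rw [Real.mul_rpow hA (norm_nonneg _)]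
    calc ∑ k ∈ s, ‖c k * x (k - m)‖ ^ (2 : ENNReal).toReal
        ≤ ∑ k ∈ s, A ^ (2 : ENNReal).toReal * ‖x (k - m)‖ ^ (2 : ENNReal).toReal := by
          refine Finset.sum_le_sum fun k _ => ?_
          rw [norm_mul, Real.mul_rpow (norm_nonneg _) (norm_nonneg _)]
          gcongr
          exact hc k
      _ = A ^ (2 : ENNReal).toReal * ∑ l ∈ s.map (Equiv.subRight m).toEmbedding,
            ‖x l‖ ^ (2 : ENNReal).toReal := by
          rw [Finset.sum_map, Finset.mul_sum]
          rfl
      _ ≤ _ := by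
          gcongr
          exact lp.sum_rpow_le_norm_rpow h2 x _
  let L : lp (fun _ : G => ℂ) 2 →ₗ[ℂ] lp (fun _ : G => ℂ) 2 :=
    { toFun := fun x => ⟨fun k => c k * x (k - m), memℓp_gen' (hbound x)⟩
      map_add' := fun x y => by
        ext k
        change c k * (x (k - m) + y (k - m)) = c k * x (k - m) + c k * y (k - m)
        ring
      map_smul' := fun r x => by
        ext k
        change c k * (r * x (k - m)) = r * (c k * x (k - m))
        ring }
  refine ⟨L.mkContinuous A fun x => ?_, L.mkContinuous_norm_le hA _, fun x k => rfl⟩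
  exact lp.norm_le_of_forall_sum_le h2 (by positivity) (hbound x)

/-- **Schur's test** for matrices dominated by a convolution kernel. -/
lemma exists_matrixOperator {K : G → G → ℂ} {a : G → ℝ} (ha : Summable a)
    (hK : ∀ k l, ‖K k l‖ ≤ a (k - l)) :
    ∃ T : lp (fun _ : G => ℂ) 2 →L[ℂ] lp (fun _ : G => ℂ) 2,
      ‖T‖ ≤ ∑' m, a m ∧ ∀ x k, HasSum (fun l => K k l * x l) (T x k) := by
  -- The matrix is split into its diagonals `k - l = m`, each a weighted shift of norm at most `a
  -- m`; their sum converges in operator norm.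
  have hshift := fun m : G => exists_weightedShift (c := fun k => K k (k - m)) (A := a m)
    (fun k => by simpa using hK k (k - m)) m
  choose E hE hEx using hshift
  have hsum : Summable E := Summable.of_norm_bounded ha hE
  refine ⟨∑' m, E m, tsum_of_norm_bounded ha.hasSum hE, fun x k => ?_⟩
  have h1 : HasSum (fun m => E m x) ((∑' m, E m) x) :=
    (ContinuousLinearMap.apply ℂ _ x).hasSum hsum.hasSum
  have h2 : HasSum (fun m => E m x k) ((∑' m, E m) x k) :=
    h1.map (lp.evalCLM ℂ (fun _ : G => ℂ) 2 k).toLinearMap.toAddMonoidHom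
      (lp.evalCLM ℂ (fun _ : G => ℂ) 2 k).continuous
  rw [← (Equiv.subLeft k).hasSum_iff]
  convert h2 using 1
  ext m
  simp [hEx]

/-- A quadratic form bound on finitely supported sequences extends to `ℓ²`. -/
lemma le_inner_matrixOperator {K : G → G → ℂ} {c : ℝ}
    {T : lp (fun _ : G => ℂ) 2 →L[ℂ] lp (fun _ : G => ℂ) 2}
    (hT : ∀ x k, HasSum (fun l => K k l * x l) (T x k))
    (hc : ∀ (s : Finset G) (v : G → ℂ), c * ∑ k ∈ s, ‖v k‖ ^ 2
      ≤ (∑ k ∈ s, ∑ l ∈ s, star (v k) * K k l * v l).re) (x : lp (fun _ : G => ℂ) 2) :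
    c * ‖x‖ ^ 2 ≤ (inner ℂ x (T x)).re := by
  classical
  have hTs : ∀ (l : G) (z : ℂ) (k : G), T (lp.single 2 l z) k = K k l * z := fun l z k => by
    refine (hT (lp.single 2 l z) k).unique ?_
    convert hasSum_single l fun j hj => ?_
    · simp
    · simp [hj]
  have hfin : ∀ s : Finset G, c * ‖∑ k ∈ s, lp.single 2 k (x k)‖ ^ 2
      ≤ (inner ℂ (∑ k ∈ s, lp.single (E := fun _ : G => ℂ) 2 k (x k))
        (T (∑ k ∈ s, lp.single 2 k (x k)))).re := fun s => by
    have h2 := lp.norm_sum_single (p := 2) (E := fun _ : G => ℂ) (by simp) (fun k => x k) s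
    simp only [ENNReal.toReal_ofNat, Real.rpow_ofNat] at h2
    rw [h2, map_sum, sum_inner]
    simp only [inner_sum, lp.inner_single_left, hTs]
    convert hc s x using 5
    simp [mul_assoc, mul_comm, mul_left_comm]
  have hlim : Filter.Tendsto (fun s : Finset G => ∑ k ∈ s, lp.single (E := fun _ : G => ℂ) 2 k (x k))
      Filter.atTop (nhds x) := lp.hasSum_single (by simp) x
  have hcont1 : Continuous fun y : lp (fun _ : G => ℂ) 2 => c * ‖y‖ ^ 2 := by fun_prop
  have hcont2 : Continuous fun y : lp (fun _ : G => ℂ) 2 => (inner ℂ y (T y)).re :=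
    Complex.continuous_re.comp (continuous_id.inner T.continuous)
  exact le_of_tendsto_of_tendsto' ((hcont1.tendsto x).comp hlim) ((hcont2.tendsto x).comp hlim) hfin

end MatrixOperators

/-! ### Rapidly decaying sequences and coercive matrix equations. -/

section RapidDecay

variable {d : ℕ}

/-- The squared Euclidean length of a frequency. -/
def freqSq (k : Fin d → ℤ) : ℝ := ∑ i, (k i : ℝ) ^ 2

lemma freqSq_nonneg (k : Fin d → ℤ) : 0 ≤ freqSq k := Finset.sum_nonneg fun _ _ => sq_nonneg _

lemma freqSq_pos {k : Fin d → ℤ} (hk : k ≠ 0) : 1 ≤ freqSq k := by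
  obtain ⟨i, hi⟩ := Function.ne_iff.1 hk
  have h1 : (1 : ℝ) ≤ (k i : ℝ) ^ 2 := by
    have hi' : k i ≠ 0 := hi
    have : 1 ≤ k i ^ 2 := Int.add_one_le_iff.2 (sq_pos_of_ne_zero hi')
    exact_mod_cast this
  exact h1.trans (Finset.single_le_sum (f := fun i => (k i : ℝ) ^ 2) (fun _ _ => sq_nonneg _)
    (Finset.mem_univ i))

/-- Faster than polynomial decay. -/
def RapidDecay (c : (Fin d → ℤ) → ℂ) : Prop :=
  ∀ N : ℕ, ∃ C : ℝ, ∀ k, (1 + freqSq k) ^ N * ‖c k‖ ≤ C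

lemma summable_inv_one_add_sq : Summable fun n : ℤ => (1 + (n : ℝ) ^ 2)⁻¹ := by
  have h : Summable fun n : ℤ => 1 / (n : ℝ) ^ 2 :=
    Real.summable_one_div_int_pow.2 one_lt_two
  have hfin : Summable fun n : ℤ => if n = 0 then (1 : ℝ) else 0 :=
    summable_of_ne_finset_zero (s := {0}) fun n hn => by simp_all
  refine Summable.of_nonneg_of_le (fun n => by positivity) (fun n => ?_) (h.add hfin)
  rcases eq_or_ne n 0 with rfl | hn
  · simp
  · have : (0 : ℝ) < (n : ℝ) ^ 2 := by positivity
    simp only [hn, if_false, add_zero, one_div]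
    gcongr
    linarith

/-- Each factor 1+kᵢ² is at most 1+|k|², so the `d`-th power dominates their product and the sum
factors into one-dimensional sums. -/
lemma summable_inv_one_add_freqSq_pow :
    Summable fun k : Fin d → ℤ => ((1 + freqSq k) ^ d)⁻¹ := by
  classical
  have hprod : ∀ k : Fin d → ℤ, ((1 + freqSq k) ^ d)⁻¹ ≤ ∏ i, (1 + (k i : ℝ) ^ 2)⁻¹ := fun k => by
    rw [Finset.prod_inv_distrib]
    refine inv_anti₀ (Finset.prod_pos fun i _ => by positivity) ?_
    calc ∏ i, (1 + (k i : ℝ) ^ 2) ≤ ∏ _i : Fin d, (1 + freqSq k) := by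
          refine Finset.prod_le_prod (fun i _ => by positivity) fun i _ => ?_
          have := Finset.single_le_sum (f := fun i => (k i : ℝ) ^ 2) (fun _ _ => sq_nonneg _)
            (Finset.mem_univ i)
          simp only [freqSq]
          linarith
      _ = _ := by simp
  refine Summable.of_nonneg_of_le (fun k => by have := freqSq_nonneg k; positivity) hprod ?_
  refine summable_of_sum_le (f := fun k : Fin d → ℤ => ∏ i, (1 + (k i : ℝ) ^ 2)⁻¹)
    (c := (∑' n : ℤ, (1 + (n : ℝ) ^ 2)⁻¹) ^ d)
    (fun k => by change 0 ≤ ∏ i, (1 + (k i : ℝ) ^ 2)⁻¹; positivity) fun s => ?_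
  calc ∑ k ∈ s, ∏ i, (1 + (k i : ℝ) ^ 2)⁻¹
      ≤ ∑ k ∈ Fintype.piFinset (fun i => s.image fun k : Fin d → ℤ => k i), ∏ i, (1 + ((k i : ℤ) : ℝ) ^ 2)⁻¹ := by
        refine Finset.sum_le_sum_of_subset_of_nonneg (fun k hk => ?_) fun k _ _ =>
          Finset.prod_nonneg fun i _ => by positivity
        exact Fintype.mem_piFinset.2 fun i => Finset.mem_image_of_mem _ hk
    _ = ∏ i, ∑ n ∈ s.image (fun k => k i), (1 + ((n : ℤ) : ℝ) ^ 2)⁻¹ := by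
        rw [Finset.prod_univ_sum]
    _ ≤ ∏ _i : Fin d, ∑' n : ℤ, (1 + (n : ℝ) ^ 2)⁻¹ := by
        refine Finset.prod_le_prod (fun i _ => Finset.sum_nonneg fun n _ => by positivity)
          fun i _ => ?_
        exact summable_inv_one_add_sq.sum_le_tsum _ fun n _ => by positivity
    _ = _ := by simp

lemma RapidDecay.summable {c : (Fin d → ℤ) → ℂ} (hc : RapidDecay c) (N : ℕ) :
    Summable fun k => (1 + freqSq k) ^ N * ‖c k‖ := by
  obtain ⟨C, hC⟩ := hc (N + d)
  refine Summable.of_nonneg_of_le (fun k => by have := freqSq_nonneg k; positivity) (fun k => ?_)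
    (summable_inv_one_add_freqSq_pow.mul_left C)
  have h1 : 0 < (1 + freqSq k) ^ d := by have := freqSq_nonneg k; positivity
  rw [← div_eq_mul_inv, le_div_iff₀ h1]
  calc _ = (1 + freqSq k) ^ (N + d) * ‖c k‖ := by ring
    _ ≤ C := hC k

lemma RapidDecay.summable_norm {c : (Fin d → ℤ) → ℂ} (hc : RapidDecay c) :
    Summable fun k => ‖c k‖ := by simpa using hc.summable 0

/-- The weight `(1 + t²|k|²)` varies slowly for small `t`. -/
lemma abs_weight_div_sub_one_le {t : ℝ} (ht : 0 < t) (ht1 : t ≤ 1) (k l : Fin d → ℤ) :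
    |(1 + t ^ 2 * freqSq k) / (1 + t ^ 2 * freqSq l) - 1| ≤ 2 * t * (1 + freqSq (k - l)) := by
  have hl := freqSq_nonneg l
  have hm := freqSq_nonneg (k - l)
  have hpos : 0 < 1 + t ^ 2 * freqSq l := by positivity
  -- The cross term of |k|² = |l + (k-l)|² is absorbed using only one of the two factors `t`; the
  -- other supplies the smallness in the final bound.
  have hcross : |∑ i, 2 * (l i : ℝ) * ((k i : ℝ) - l i)| * t
      ≤ t ^ 2 * freqSq l + freqSq (k - l) := by
    rw [← abs_of_pos ht, ← abs_mul, abs_of_pos ht, Finset.sum_mul]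
    refine (Finset.abs_sum_le_sum_abs _ _).trans ?_
    simp only [freqSq, Finset.mul_sum, ← Finset.sum_add_distrib]
    refine Finset.sum_le_sum fun i _ => ?_
    simp only [Pi.sub_apply, Int.cast_sub]
    exact abs_le.2 ⟨by nlinarith [sq_nonneg (t * (l i : ℝ) + ((k i : ℝ) - l i))],
      by nlinarith [sq_nonneg (t * (l i : ℝ) - ((k i : ℝ) - l i))]⟩
  have hk : freqSq k = freqSq l + (∑ i, 2 * (l i : ℝ) * ((k i : ℝ) - l i)) + freqSq (k - l) := by
    simp only [freqSq, ← Finset.sum_add_distrib, Pi.sub_apply, Int.cast_sub]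
    exact Finset.sum_congr rfl fun i _ => by ring
  rw [div_sub_one hpos.ne', abs_div, abs_of_pos hpos, div_le_iff₀ hpos]
  have h1 : (1 + t ^ 2 * freqSq k) - (1 + t ^ 2 * freqSq l)
      = t * ((∑ i, 2 * (l i : ℝ) * ((k i : ℝ) - l i)) * t) + t ^ 2 * freqSq (k - l) := by
    rw [hk]; ring
  rw [h1]
  calc _ ≤ |t * ((∑ i, 2 * (l i : ℝ) * ((k i : ℝ) - l i)) * t)| + |t ^ 2 * freqSq (k - l)| :=
        abs_add_le _ _
    _ = t * (|∑ i, 2 * (l i : ℝ) * ((k i : ℝ) - l i)| * t) + t ^ 2 * freqSq (k - l) := by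
        rw [abs_mul, abs_mul, abs_of_pos ht, abs_of_nonneg (by positivity : 0 ≤ t ^ 2 * _)]
    _ ≤ t * (t ^ 2 * freqSq l + freqSq (k - l)) + t * freqSq (k - l) := by
        have : t ^ 2 ≤ t := by nlinarith
        gcongr
    _ ≤ 2 * t * (1 + freqSq (k - l)) * (1 + t ^ 2 * freqSq l) := by
        have h3 : 0 ≤ t * (t ^ 2 * freqSq l) := by positivity
        have h4 : 0 ≤ t * freqSq (k - l) * (t ^ 2 * freqSq l) := by positivity
        nlinarith

lemma abs_pow_sub_one_le {u δ Q : ℝ} (hu : 0 ≤ u) (huQ : u ≤ Q) (hQ : 1 ≤ Q) (h : |u - 1| ≤ δ)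
    (N : ℕ) : |u ^ N - 1| ≤ N * δ * Q ^ N := by
  have hδ : 0 ≤ δ := (abs_nonneg _).trans h
  induction N with
  | zero => simp
  | succ N ih =>
    have h1 : u ^ (N + 1) - 1 = u * (u ^ N - 1) + (u - 1) := by ring
    have h2 : 1 ≤ Q ^ (N + 1) := one_le_pow₀ hQ
    calc |u ^ (N + 1) - 1| ≤ |u * (u ^ N - 1)| + |u - 1| := h1 ▸ abs_add_le _ _
      _ = u * |u ^ N - 1| + |u - 1| := by rw [abs_mul, abs_of_nonneg hu]
      _ ≤ Q * (N * δ * Q ^ N) + δ * Q ^ (N + 1) := by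
          gcongr
          exact h.trans (le_mul_of_one_le_right hδ h2)
      _ = _ := by push_cast; ring

/-- Conjugating a matrix by the weight alters each entry by a relative error of size `t` times a
polynomial in |k-l|², which a rapidly decaying kernel absorbs. -/
lemma abs_weight_pow_sub_one_le {t : ℝ} (ht : 0 < t) (ht1 : t ≤ 1) (N : ℕ) (k l : Fin d → ℤ) :
    |(1 + t ^ 2 * freqSq k) ^ N / (1 + t ^ 2 * freqSq l) ^ N - 1|
      ≤ t * (2 * N * 3 ^ N * (1 + freqSq (k - l)) ^ (N + 1)) := by
  have hk := freqSq_nonneg k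
  have hl := freqSq_nonneg l
  have hm := freqSq_nonneg (k - l)
  have h1 := abs_weight_div_sub_one_le ht ht1 k l
  have h2 : (1 + t ^ 2 * freqSq k) / (1 + t ^ 2 * freqSq l) ≤ 3 * (1 + freqSq (k - l)) := by
    have := (abs_le.1 h1).2
    nlinarith
  rw [← div_pow]
  refine (abs_pow_sub_one_le (by positivity) h2 (by linarith) h1 N).trans (le_of_eq ?_)
  rw [mul_pow]
  ring

/-- Unique solvability with rapid decay of coercive matrix equations on `ℤ^d`, whose matrix is
dominated by a rapidly decaying convolution kernel. -/
theorem exists_rapidDecay_solution {b h : (Fin d → ℤ) → ℂ} {K : (Fin d → ℤ) → (Fin d → ℤ) → ℂ}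
    (hb : RapidDecay b) (hh : RapidDecay h) (hK : ∀ k l, ‖K k l‖ ≤ ‖b (k - l)‖) {c : ℝ}
    (hc : 0 < c) (hcoer : ∀ (s : Finset (Fin d → ℤ)) (v : (Fin d → ℤ) → ℂ),
      c * ∑ k ∈ s, ‖v k‖ ^ 2 ≤ (∑ k ∈ s, ∑ l ∈ s, star (v k) * K k l * v l).re) :
    ∃ x : (Fin d → ℤ) → ℂ, RapidDecay x ∧ ∀ k, HasSum (fun l => K k l * x l) (h k) := by
  obtain ⟨T, -, hT⟩ := exists_matrixOperator hb.summable_norm hK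
  have hTc := le_inner_matrixOperator hT hcoer
  have main : ∀ N : ℕ, ∃ x : lp (fun _ : Fin d → ℤ => ℂ) 2,
      (∃ C : ℝ, ∀ k, (1 + freqSq k) ^ N * ‖x k‖ ≤ C) ∧ ∀ k, T x k = h k := by
    intro N
    set S : ℝ := ∑' m, 2 * N * 3 ^ N * ((1 + freqSq m) ^ (N + 1) * ‖b m‖) with hS
    have hSs : Summable fun m => 2 * N * 3 ^ N * ((1 + freqSq m) ^ (N + 1) * ‖b m‖) :=
      (hb.summable (N + 1)).mul_left _
    have hS0 : 0 ≤ S := tsum_nonneg fun m => by have := freqSq_nonneg m; positivity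
    -- `t * S` will bound the norm of the perturbation caused by the weights; c/2 leaves half of the
    -- coercivity.
    obtain ⟨t, ht, ht1, htS⟩ : ∃ t : ℝ, 0 < t ∧ t ≤ 1 ∧ t * S ≤ c / 2 := by
      refine ⟨min 1 (c / (2 * (S + 1))), by positivity, min_le_left _ _, ?_⟩
      calc _ ≤ c / (2 * (S + 1)) * (S + 1) := by
            gcongr
            · exact min_le_right _ _
            · linarith
        _ = c / 2 := by field_simp
    set w : (Fin d → ℤ) → ℝ := fun k => (1 + t ^ 2 * freqSq k) ^ N with hw
    have hw1 : ∀ k, 1 ≤ w k := fun k => one_le_pow₀ (by have := freqSq_nonneg k; nlinarith)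
    have hw0 : ∀ k, w k ≠ 0 := fun k => (zero_lt_one.trans_le (hw1 k)).ne'
    -- `T + D` is the conjugate of the matrix by the weight `w`. Solving it for the right-hand side
    -- `w h` and dividing by `w` gives a solution of the original equation with decay of order `N`.
    obtain ⟨D, hD, hDx⟩ := exists_matrixOperator (K := fun k l => ((w k / w l - 1 : ℝ) : ℂ) * K k l)
      (hSs.mul_left t) (fun k l => by
        rw [norm_mul, Complex.norm_real, Real.norm_eq_abs]
        calc _ ≤ t * (2 * N * 3 ^ N * (1 + freqSq (k - l)) ^ (N + 1)) * ‖b (k - l)‖ :=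
              mul_le_mul (abs_weight_pow_sub_one_le ht ht1 N k l) (hK k l) (norm_nonneg _)
                (by have := freqSq_nonneg (k - l); positivity)
          _ = _ := by ring)
    rw [tsum_mul_left, ← hS] at hD
    have hTD : ∀ x k, HasSum (fun l => ((w k / w l : ℝ) : ℂ) * K k l * x l) ((T + D) x k) :=
      fun x k => by
        rw [show (T + D) x k = T x k + D x k from rfl]
        convert (hT x k).add (hDx x k) using 1
        ext l
        push_cast
        ring
    have hunit : IsUnit (T + D) := by
      refine ContinuousLinearMap.isUnit_of_forall_le_norm_inner_map (T + D)
        (c := ⟨c / 2, by positivity⟩) (by exact_mod_cast half_pos hc) fun x => ?_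
      have h1 := hTc x
      have h2 : |(inner ℂ x (D x)).re| ≤ c / 2 * ‖x‖ ^ 2 := by
        refine (Complex.abs_re_le_norm _).trans ((norm_inner_le_norm _ _).trans ?_)
        calc ‖x‖ * ‖D x‖ ≤ ‖x‖ * (c / 2 * ‖x‖) := by
              gcongr
              exact D.le_of_opNorm_le (hD.trans htS) x
          _ = _ := by ring
      rw [norm_inner_symm]
      calc ‖x‖ ^ 2 * (c / 2) ≤ (inner ℂ x ((T + D) x)).re := by
            rw [add_apply, inner_add_right, Complex.add_re]
            linarith [(abs_le.1 h2).1]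
        _ ≤ _ := Complex.re_le_norm _
    have hwh : Memℓp (fun k => (w k : ℂ) * h k) 2 := by
      have hwle : ∀ k, w k ≤ (1 + freqSq k) ^ N := fun k => by
        have := freqSq_nonneg k
        refine pow_le_pow_left₀ (by positivity) ?_ N
        have : t ^ 2 ≤ 1 := pow_le_one₀ ht.le ht1
        nlinarith
      have hs : Summable fun k => ‖(w k : ℂ) * h k‖ := by
        refine Summable.of_nonneg_of_le (fun k => norm_nonneg _) (fun k => ?_) (hh.summable N)
        rw [norm_mul, Complex.norm_real, Real.norm_eq_abs,
          abs_of_pos (zero_lt_one.trans_le (hw1 k))]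
        gcongr
        exact hwle k
      have h1 : Memℓp (fun k => (w k : ℂ) * h k) 1 := memℓp_gen (by simpa using hs)
      exact h1.of_exponent_ge (by norm_num)
    obtain ⟨y, hy⟩ := (ContinuousLinearMap.isUnit_iff_bijective.1 hunit).2 ⟨_, hwh⟩
    have hwinv : ∀ k, ‖((w k : ℂ))⁻¹ * y k‖ ≤ ‖y k‖ := fun k => by
      rw [norm_mul, norm_inv, Complex.norm_real, Real.norm_eq_abs,
        abs_of_pos (zero_lt_one.trans_le (hw1 k))]
      exact mul_le_of_le_one_left (norm_nonneg _) (inv_le_one_of_one_le₀ (hw1 k))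
    have hx : Memℓp (fun k => ((w k : ℂ))⁻¹ * y k) 2 := by
      refine memℓp_gen (Summable.of_nonneg_of_le (fun k => by positivity) (fun k => ?_)
        ((memℓp_gen_iff (by simp)).1 (lp.memℓp y)))
      exact Real.rpow_le_rpow (norm_nonneg _) (hwinv k) (by simp)
    refine ⟨⟨_, hx⟩, ⟨‖y‖ / t ^ (2 * N), fun k => ?_⟩, fun k => ?_⟩
    · have hq := freqSq_nonneg k
      have h1 : t ^ (2 * N) * (1 + freqSq k) ^ N ≤ w k := by
        rw [pow_mul, ← mul_pow]
        refine pow_le_pow_left₀ (by positivity) ?_ N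
        have : t ^ 2 ≤ 1 := pow_le_one₀ ht.le ht1
        nlinarith
      change (1 + freqSq k) ^ N * ‖((w k : ℂ))⁻¹ * y k‖ ≤ _
      rw [norm_mul, norm_inv, Complex.norm_real, Real.norm_eq_abs,
        abs_of_pos (zero_lt_one.trans_le (hw1 k)), le_div_iff₀ (by positivity)]
      have hyk : ‖y k‖ ≤ ‖y‖ := lp.norm_apply_le_norm (by simp) y k
      have hwk := zero_lt_one.trans_le (hw1 k)
      calc _ = (t ^ (2 * N) * (1 + freqSq k) ^ N) * (w k)⁻¹ * ‖y k‖ := by ring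
        _ ≤ w k * (w k)⁻¹ * ‖y‖ := by gcongr
        _ = ‖y‖ := by rw [mul_inv_cancel₀ (hw0 k), one_mul]
    · have h1 := (hTD y k).mul_left ((w k : ℂ))⁻¹
      have h2 : (T + D) y k = (w k : ℂ) * h k := by rw [hy]
      have hwk : (w k : ℂ) ≠ 0 := by exact_mod_cast hw0 k
      rw [h2, ← mul_assoc, inv_mul_cancel₀ hwk, one_mul] at h1
      refine (hT _ k).unique (h1.congr_fun fun l => ?_)
      change K k l * (((w l : ℂ))⁻¹ * y l) = _
      push_cast
      field_simp
  choose x hx hTx using main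
  -- The construction depends on `N`, but coercivity of `T` makes the ℓ² solution unique, so a
  -- single sequence has every order of decay.
  have hinj : ∀ N, x N = x 0 := fun N => by
    have h0 : T (x N - x 0) = 0 := by
      ext k
      simp [hTx]
    have h1 := hTc (x N - x 0)
    rw [h0, inner_zero_right, Complex.zero_re] at h1
    have h2 : ‖x N - x 0‖ ^ 2 = 0 := le_antisymm (by nlinarith) (sq_nonneg _)
    exact sub_eq_zero.1 (norm_eq_zero.1 (pow_eq_zero_iff two_ne_zero |>.1 h2))
  refine ⟨x 0, fun N => hinj N ▸ hx N, fun k => ?_⟩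
  rw [← hTx 0 k]
  exact hT (x 0) k

end RapidDecay

end TransportHessian

namespace TransportHessian

/-! ### Fourier modes, smoothness of series and completeness. -/

section FourierModes

variable {d : ℕ}

/-- The linear phase `x ↦ 2π k·x`. -/
noncomputable def phase (k : Fin d → ℤ) : (Fin d → ℝ) →L[ℝ] ℝ :=
  ∑ i, (2 * Real.pi * k i) • ContinuousLinearMap.proj i

lemma phase_apply (k : Fin d → ℤ) (x : Fin d → ℝ) :
    phase k x = 2 * Real.pi * ∑ i, k i * x i := by
  simp [phase, Finset.mul_sum, mul_assoc]

lemma phase_single (k : Fin d → ℤ) (i : Fin d) :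
    phase k (Pi.single i 1) = 2 * Real.pi * k i := by
  simp [phase_apply, Pi.single_apply]

lemma phase_add (k l : Fin d → ℤ) (x : Fin d → ℝ) : phase (k + l) x = phase k x + phase l x := by
  simp [phase_apply, add_mul, Finset.sum_add_distrib, mul_add]

lemma phase_neg (k : Fin d → ℤ) (x : Fin d → ℝ) : phase (-k) x = -phase k x := by
  simp [phase_apply]

lemma norm_phase_le (k : Fin d → ℤ) : ‖phase k‖ ≤ 2 * Real.pi * d * (1 + freqSq k) := by
  have hq := freqSq_nonneg k
  refine ContinuousLinearMap.opNorm_le_bound _ (by positivity) fun x => ?_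
  rw [phase_apply, norm_mul, Real.norm_of_nonneg (by positivity), mul_assoc (2 * Real.pi),
    mul_assoc (2 * Real.pi)]
  gcongr
  calc ‖∑ i, (k i : ℝ) * x i‖ ≤ ∑ i, ‖(k i : ℝ) * x i‖ := norm_sum_le _ _
    _ ≤ ∑ _i : Fin d, (1 + freqSq k) * ‖x‖ := by
        refine Finset.sum_le_sum fun i _ => ?_
        rw [norm_mul]
        gcongr
        · have h1 := Finset.single_le_sum (f := fun i => (k i : ℝ) ^ 2) (fun _ _ => sq_nonneg _)
            (Finset.mem_univ i)
          change (k i : ℝ) ^ 2 ≤ freqSq k at h1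
          rw [Real.norm_eq_abs]
          nlinarith [sq_abs (k i : ℝ), sq_nonneg (|(k i : ℝ)| - 1), abs_nonneg (k i : ℝ)]
        · exact norm_le_pi_norm x i
    _ = _ := by simp; ring

/-- The Fourier mode `x ↦ exp(2πi k·x)`. -/
noncomputable def expMode (k : Fin d → ℤ) (x : Fin d → ℝ) : ℂ :=
  Complex.exp (phase k x * Complex.I)

lemma expMode_add (k l : Fin d → ℤ) (x : Fin d → ℝ) :
    expMode (k + l) x = expMode k x * expMode l x := by
  rw [expMode, phase_add, Complex.ofReal_add, add_mul, Complex.exp_add]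
  rfl

lemma expMode_zero (x : Fin d → ℝ) : expMode 0 x = 1 := by
  simp [expMode, phase_apply]

lemma norm_expMode (k : Fin d → ℤ) (x : Fin d → ℝ) : ‖expMode k x‖ = 1 :=
  Complex.norm_exp_ofReal_mul_I _

lemma star_expMode (k : Fin d → ℤ) (x : Fin d → ℝ) : star (expMode k x) = expMode (-k) x := by
  rw [expMode, expMode, phase_neg, Complex.star_def, ← Complex.exp_conj]
  simp

lemma contDiff_expMode (k : Fin d → ℤ) : ContDiff ℝ ∞ (expMode k) :=
  ((Complex.ofRealCLM.contDiff.comp (phase k).contDiff).mul contDiff_const).cexp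

lemma continuous_expMode (k : Fin d → ℤ) : Continuous (expMode k) :=
  (contDiff_expMode k).continuous

lemma expMode_periodic (k : Fin d → ℤ) (x : Fin d → ℝ) (m : Fin d → ℤ) :
    expMode k (x + fun i => (m i : ℝ)) = expMode k x := by
  have h : phase k (fun i => (m i : ℝ)) = ((∑ i, k i * m i : ℤ) : ℝ) * (2 * Real.pi) := by
    rw [phase_apply]; push_cast; ring
  rw [expMode, map_add, h, expMode]
  have := Complex.exp_periodic.int_mul (∑ i, k i * m i) (phase k x * Complex.I)
  rw [← this]
  congr 1
  push_cast
  ring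

lemma hasFDerivAt_expMode (k : Fin d → ℤ) (x : Fin d → ℝ) :
    HasFDerivAt (expMode k)
      (expMode k x • (Complex.ofRealCLM.comp (phase k)).smulRight Complex.I) x := by
  have h := (Complex.ofRealCLM.comp (phase k)).hasFDerivAt (x := x)
  exact (h.mul_const' Complex.I).cexp

lemma fderiv_expMode_single (k : Fin d → ℤ) (i : Fin d) (x : Fin d → ℝ) :
    fderiv ℝ (expMode k) x (Pi.single i 1) = 2 * Real.pi * k i * Complex.I * expMode k x := by
  rw [(hasFDerivAt_expMode k x).fderiv]
  simp [phase_single]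
  ring

/-- The mode is a linear phase followed by t ↦ exp(it), all of whose derivatives have modulus one.
-/
lemma norm_iteratedFDeriv_expMode_le (k : Fin d → ℤ) (n : ℕ) (x : Fin d → ℝ) :
    ‖iteratedFDeriv ℝ n (expMode k) x‖ ≤ ‖phase k‖ ^ n := by
  have hsm : ContDiff ℝ ∞ fun t : ℝ => Complex.exp (t * Complex.I) :=
    (Complex.ofRealCLM.contDiff.mul contDiff_const).cexp
  have hiter : ∀ n : ℕ, iteratedDeriv n (fun t : ℝ => Complex.exp (t * Complex.I))
      = fun t : ℝ => Complex.I ^ n * Complex.exp (t * Complex.I) := fun n => by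
    induction n with
    | zero => simp
    | succ n ih =>
      rw [iteratedDeriv_succ, ih]
      ext t
      have h1 : HasDerivAt (fun t : ℝ => (t : ℂ) * Complex.I) Complex.I t := by
        simpa using (Complex.ofRealCLM.hasDerivAt (x := t)).mul_const Complex.I
      rw [(h1.cexp.const_mul (Complex.I ^ n)).deriv]
      ring
  have hcomp : expMode k = (fun t : ℝ => Complex.exp (t * Complex.I)) ∘ phase k := rfl
  rw [hcomp, (phase k).iteratedFDeriv_comp_right hsm x (i := n) (by exact_mod_cast le_top)]
  refine (ContinuousMultilinearMap.norm_compContinuousLinearMap_le _ _).trans ?_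
  rw [norm_iteratedFDeriv_eq_norm_iteratedDeriv, hiter]
  simp [Complex.norm_exp_ofReal_mul_I]

/-- A trigonometric series with rapidly decaying coefficients is smooth. -/
lemma RapidDecay.contDiff_tsum {c : (Fin d → ℤ) → ℂ} (hc : RapidDecay c) :
    ContDiff ℝ ∞ fun x => ∑' k, c k * expMode k x := by
  refine _root_.contDiff_tsum
    (v := fun n k => (2 * Real.pi * d) ^ n * ((1 + freqSq k) ^ n * ‖c k‖))
    (fun k => contDiff_const.mul (contDiff_expMode k)) (fun n _ => (hc.summable n).mul_left _)
    fun n k x _ => ?_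
  have : (fun x => c k * expMode k x) = c k • expMode k := rfl
  rw [this, iteratedFDeriv_const_smul_apply ((contDiff_expMode k).contDiffAt.of_le
    (by exact_mod_cast le_top)), norm_smul]
  calc ‖c k‖ * ‖iteratedFDeriv ℝ n (expMode k) x‖
      ≤ ‖c k‖ * (2 * Real.pi * d * (1 + freqSq k)) ^ n := by
        gcongr
        exact (norm_iteratedFDeriv_expMode_le k n x).trans
          (pow_le_pow_left₀ (norm_nonneg _) (norm_phase_le k) n)
    _ = _ := by rw [mul_pow]; ring

/-- A continuous periodic function all of whose Fourier coefficients vanish is zero. -/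
theorem eq_zero_of_forall_setIntegral_mul_expMode {g : (Fin d → ℝ) → ℂ} (hg : Continuous g)
    (hper : ∀ (x : Fin d → ℝ) (k : Fin d → ℤ), g (x + fun i => (k i : ℝ)) = g x)
    (h : ∀ k : Fin d → ℤ, ∫ x in Icc (0 : Fin d → ℝ) 1, g x * expMode k x = 0) (x : Fin d → ℝ) :
    g x = 0 := by
  -- Passing to the quotient torus gives access to the density of trigonometric polynomials in the
  -- uniform norm.
  let q : C(Fin d → ℝ, UnitAddTorus (Fin d)) :=
    ⟨Pi.map fun _ t => (t : UnitAddCircle), Continuous.piMap fun _ => AddCircle.continuous_mk' 1⟩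
  have hq : Topology.IsQuotientMap q :=
    (IsOpenQuotientMap.piMap fun _ => QuotientAddGroup.isOpenQuotientMap_mk).isQuotientMap
  have hcompat : ∀ a b, q a = q b → g a = g b := fun a b hab => by
    have h1 : ∀ i, ∃ n : ℤ, n • (1 : ℝ) = a i - b i := fun i => by
      have h2 : ((a i : ℝ) : UnitAddCircle) = (b i : ℝ) := congrFun hab i
      rw [← AddCircle.coe_eq_zero_iff (1 : ℝ), AddCircle.coe_sub, h2, sub_self]
    choose n hn using h1
    rw [← hper b n]
    congr 1
    ext i
    have := hn i
    simp only [zsmul_eq_mul, mul_one] at this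
    simp [this]
  let G : C(UnitAddTorus (Fin d), ℂ) := hq.lift ⟨g, hg⟩ hcompat
  have hG : ∀ x, G (q x) = g x := fun x => by
    have := hq.lift_comp ⟨g, hg⟩ hcompat
    exact DFunLike.congr_fun this x
  obtain ⟨M, hM⟩ := isCompact_Icc.exists_bound_of_continuousOn
    (s := Icc (0 : Fin d → ℝ) 1) hg.continuousOn
  have hint : ∀ P : C(UnitAddTorus (Fin d), ℂ),
      IntegrableOn (fun x => g x * P (q x)) (Icc (0 : Fin d → ℝ) 1) := fun P =>
    (hg.mul (P.continuous.comp q.continuous)).continuousOn.integrableOn_compact isCompact_Icc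
  let J : C(UnitAddTorus (Fin d), ℂ) →ₗ[ℂ] ℂ :=
    { toFun := fun P => ∫ x in Icc (0 : Fin d → ℝ) 1, g x * P (q x)
      map_add' := fun P Q => by
        rw [← integral_add (hint P) (hint Q)]
        simp only [ContinuousMap.add_apply, mul_add]
      map_smul' := fun c P => by
        rw [RingHom.id_apply, smul_eq_mul, ← integral_const_mul]
        congr 1
        ext x
        simp only [ContinuousMap.smul_apply, smul_eq_mul]
        ring }
  have hJb : ∀ P, ‖J P‖ ≤ M * ‖P‖ := fun P => by
    have h1 := norm_setIntegral_le_of_norm_le_const (μ := volume) (s := Icc (0 : Fin d → ℝ) 1)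
      (f := fun x => g x * P (q x)) (C := M * ‖P‖) isCompact_Icc.measure_lt_top fun x hx => by
        rw [norm_mul]
        exact mul_le_mul (hM x hx) (P.norm_coe_le_norm _) (norm_nonneg _)
          ((norm_nonneg _).trans (hM x hx))
    rwa [volume_cell, mul_one] at h1
  let J' := J.mkContinuous M hJb
  have hmode : ∀ k : Fin d → ℤ, ∀ x, UnitAddTorus.mFourier k (q x) = expMode k x := fun k x => by
    change ∏ i, fourier (k i) ((x i : ℝ) : UnitAddCircle) = _
    simp only [fourier_coe_apply]
    rw [← Complex.exp_sum, expMode, phase_apply]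
    congr 1
    push_cast
    rw [Finset.mul_sum, Finset.sum_mul]
    refine Finset.sum_congr rfl fun i _ => ?_
    ring
  have hker : (⊤ : Submodule ℂ C(UnitAddTorus (Fin d), ℂ)) ≤ LinearMap.ker J'.toLinearMap := by
    rw [← UnitAddTorus.span_mFourier_closure_eq_top]
    refine Submodule.topologicalClosure_minimal _ (Submodule.span_le.2 ?_) J'.isClosed_ker
    rintro _ ⟨k, rfl⟩
    change ∫ x in Icc (0 : Fin d → ℝ) 1, g x * UnitAddTorus.mFourier k (q x) = 0
    simp only [hmode, h]
  -- The functional vanishes on all continuous functions; evaluating it at the conjugate of `g`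
  -- yields ∫|g|² = 0.
  have hstar : ∫ x in Icc (0 : Fin d → ℝ) 1, g x * star G (q x) = 0 :=
    hker (Submodule.mem_top : star G ∈ ⊤)
  have hsq : ∀ x, g x * star G (q x) = ((‖g x‖ ^ 2 : ℝ) : ℂ) := fun x => by
    rw [ContinuousMap.star_apply, hG, Complex.star_def, Complex.mul_conj, Complex.normSq_eq_norm_sq]
  simp only [hsq] at hstar
  rw [integral_complex_ofReal] at hstar
  have := eq_zero_of_setIntegral_cell_eq_zero (f := fun x => ‖g x‖ ^ 2) (by fun_prop)
    (fun x k => by rw [hper]) (fun x => sq_nonneg _) (Complex.ofReal_eq_zero.1 hstar) x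
  exact norm_eq_zero.1 (pow_eq_zero_iff two_ne_zero |>.1 this)

end FourierModes

/-! ### Fourier coefficients, their decay, and Toeplitz forms. -/

section FourierCoefficients

variable {d : ℕ} {f g ρ σ : (Fin d → ℝ) → ℝ}

/-- The Fourier coefficient of a real periodic function. -/
noncomputable def torusCoeff (f : (Fin d → ℝ) → ℝ) (k : Fin d → ℤ) : ℂ :=
  ∫ x in Icc (0 : Fin d → ℝ) 1, (f x : ℂ) * expMode (-k) x

lemma integrableOn_mul_expMode (hf : IsTorusSmooth f) (k : Fin d → ℤ) :
    IntegrableOn (fun x => (f x : ℂ) * expMode k x) (Icc (0 : Fin d → ℝ) 1) :=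
  ((Complex.continuous_ofReal.comp hf.continuous).mul
    (continuous_expMode k)).continuousOn.integrableOn_compact isCompact_Icc

lemma torusCoeff_sub (hf : IsTorusSmooth f) (hg : IsTorusSmooth g) (k : Fin d → ℤ) :
    torusCoeff (fun x => f x - g x) k = torusCoeff f k - torusCoeff g k := by
  rw [torusCoeff, torusCoeff, torusCoeff, ← integral_sub (integrableOn_mul_expMode hf _)
    (integrableOn_mul_expMode hg _)]
  simp only [Complex.ofReal_sub, sub_mul]

lemma torusCoeff_const_mul (c : ℝ) (f : (Fin d → ℝ) → ℝ) (k : Fin d → ℤ) :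
    torusCoeff (fun x => c * f x) k = c * torusCoeff f k := by
  rw [torusCoeff, torusCoeff, ← integral_const_mul]
  simp only [Complex.ofReal_mul, mul_assoc]

lemma torusCoeff_sum {ι : Type*} {s : Finset ι} {F : ι → (Fin d → ℝ) → ℝ}
    (hF : ∀ i ∈ s, IsTorusSmooth (F i)) (k : Fin d → ℤ) :
    torusCoeff (fun x => ∑ i ∈ s, F i x) k = ∑ i ∈ s, torusCoeff (F i) k := by
  simp only [torusCoeff]
  rw [← integral_finsetSum s fun i hi => integrableOn_mul_expMode (hF i hi) _]
  simp only [Complex.ofReal_sum, Finset.sum_mul]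

lemma torusCoeff_pd (hf : IsTorusSmooth f) (i : Fin d) (k : Fin d → ℤ) :
    torusCoeff (pd i f) k = 2 * Real.pi * k i * Complex.I * torusCoeff f k := by
  have hF : ContDiff ℝ ∞ fun x => (f x : ℂ) * expMode (-k) x :=
    (Complex.ofRealCLM.contDiff.comp hf.contDiff).mul (contDiff_expMode _)
  have hd : ∀ x, fderiv ℝ (fun x => (f x : ℂ) * expMode (-k) x) x (Pi.single i 1)
      = (pd i f x : ℂ) * expMode (-k) x
        - 2 * Real.pi * k i * Complex.I * ((f x : ℂ) * expMode (-k) x) := fun x => by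
    have h1 : HasFDerivAt (fun x => (f x : ℂ)) (Complex.ofRealCLM.comp (fderiv ℝ f x)) x :=
      Complex.ofRealCLM.hasFDerivAt.comp x (hf.differentiable x).hasFDerivAt
    have h2 := ((contDiff_expMode (-k)).differentiable (by simp) x).hasFDerivAt
    rw [(h1.fun_mul h2).fderiv]
    simp only [add_apply, smul_apply, fderiv_expMode_single, smul_eq_mul,
      ContinuousLinearMap.comp_apply, Complex.ofRealCLM_apply, Pi.neg_apply, Int.cast_neg, pd]
    ring
  have h0 := setIntegral_fderiv_single_eq_zero (hF.of_le (by simp))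
    (fun x m => by rw [hf.periodic, expMode_periodic]) i
  simp only [hd] at h0
  rw [integral_sub (integrableOn_mul_expMode (hf.pd i) _)
    ((integrableOn_mul_expMode hf _).const_mul _), integral_const_mul] at h0
  exact sub_eq_zero.1 h0

lemma torusCoeff_laplacian (hf : IsTorusSmooth f) (k : Fin d → ℤ) :
    torusCoeff (laplacian f) k = -(4 * Real.pi ^ 2 * freqSq k : ℝ) * torusCoeff f k := by
  have : laplacian f = fun x => ∑ i, pd i (pd i f) x := rfl
  rw [this, torusCoeff_sum fun i _ => (hf.pd i).pd i]
  simp only [torusCoeff_pd (hf.pd _), torusCoeff_pd hf, freqSq]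
  push_cast
  rw [Finset.mul_sum, ← Finset.sum_neg_distrib, Finset.sum_mul]
  refine Finset.sum_congr rfl fun i _ => ?_
  linear_combination (4 * Real.pi ^ 2 * (k i : ℂ) ^ 2 * torusCoeff f k) * Complex.I_sq

/-- The operator 1 - Δ/(4π²) multiplies the `k`-th coefficient by 1+|k|², so each order of decay
costs one application of it. -/
lemma rapidDecay_torusCoeff (hf : IsTorusSmooth f) : RapidDecay (torusCoeff f) := by
  intro N
  induction N generalizing f with
  | zero =>
    obtain ⟨M, hM, hMf⟩ := hf.exists_abs_le
    refine ⟨M, fun k => ?_⟩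
    have h1 := norm_setIntegral_le_of_norm_le_const (μ := volume) (s := Icc (0 : Fin d → ℝ) 1)
      (f := fun x => (f x : ℂ) * expMode (-k) x) (C := M) isCompact_Icc.measure_lt_top fun x _ => by
        rw [norm_mul, norm_expMode, mul_one, Complex.norm_real]
        exact hMf x
    rw [volume_cell, mul_one] at h1
    simpa [torusCoeff] using h1
  | succ N ih =>
    set c : ℝ := (4 * Real.pi ^ 2)⁻¹
    have hs : IsTorusSmooth fun x => f x - c * laplacian f x := hf.sub (hf.laplacian.const_mul c)
    obtain ⟨C, hC⟩ := ih hs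
    refine ⟨C, fun k => ?_⟩
    have hq := freqSq_nonneg k
    have h1 : torusCoeff (fun x => f x - c * laplacian f x) k
        = ((1 + freqSq k : ℝ) : ℂ) * torusCoeff f k := by
      rw [torusCoeff_sub hf (hf.laplacian.const_mul c), torusCoeff_const_mul,
        torusCoeff_laplacian hf]
      have : (c : ℂ) * ((4 * Real.pi ^ 2 * freqSq k : ℝ) : ℂ) = freqSq k := by
        rw [← Complex.ofReal_mul]
        congr 1
        have := Real.pi_pos
        simp only [c]
        field_simp
      rw [Complex.ofReal_add, Complex.ofReal_one]
      linear_combination torusCoeff f k * this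
    have h2 := hC k
    rw [h1, norm_mul, Complex.norm_real, Real.norm_of_nonneg (by positivity)] at h2
    calc _ = (1 + freqSq k) ^ N * ((1 + freqSq k) * ‖torusCoeff f k‖) := by ring
      _ ≤ C := h2

lemma torusCoeff_zero (f : (Fin d → ℝ) → ℝ) : torusCoeff f 0 = torusIntegral f := by
  simp only [torusCoeff, neg_zero, expMode_zero, mul_one]
  exact integral_complex_ofReal

lemma torusCoeff_one_of_ne {k : Fin d → ℤ} (hk : k ≠ 0) :
    torusCoeff (fun _ : Fin d → ℝ => 1) k = 0 := by
  obtain ⟨i, hi⟩ := Function.ne_iff.1 hk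
  have h := torusCoeff_pd (IsTorusSmooth.const 1) i k
  rw [funext (pd_const i 1)] at h
  have h0 : torusCoeff (fun _ : Fin d → ℝ => 0) k = 0 := by simp [torusCoeff]
  rw [h0] at h
  have hki : (k i : ℂ) ≠ 0 := by exact_mod_cast hi
  have := Real.pi_ne_zero
  simpa [hki, this] using h.symm

/-- The source of coercivity: a lower bound on ρ becomes one on its Toeplitz form, and ρ = 1 gives
Parseval's identity. -/
lemma sum_torusCoeff_sub (hρ : IsTorusSmooth ρ) (s : Finset (Fin d → ℤ)) (v : (Fin d → ℤ) → ℂ) :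
    ∑ k ∈ s, ∑ l ∈ s, star (v k) * torusCoeff ρ (k - l) * v l
      = (torusIntegral fun x => ρ x * ‖∑ k ∈ s, v k * expMode k x‖ ^ 2 : ℝ) := by
  have hpt : ∀ x, ((ρ x * ‖∑ k ∈ s, v k * expMode k x‖ ^ 2 : ℝ) : ℂ)
      = ∑ k ∈ s, ∑ l ∈ s, star (v k) * v l * ((ρ x : ℂ) * expMode (-(k - l)) x) := fun x => by
    push_cast
    rw [← Complex.conj_mul', map_sum, Finset.sum_mul_sum, Finset.mul_sum]
    refine Finset.sum_congr rfl fun k _ => ?_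
    rw [Finset.mul_sum]
    refine Finset.sum_congr rfl fun l _ => ?_
    rw [map_mul, ← Complex.star_def, star_expMode, neg_sub, sub_eq_neg_add,
      expMode_add]
    ring
  have hI := fun k l : Fin d → ℤ => (integrableOn_mul_expMode hρ (-(k - l))).const_mul
    (star (v k) * v l)
  rw [torusIntegral, ← integral_complex_ofReal]
  change _ = ∫ x in Icc (0 : Fin d → ℝ) 1, ((ρ x * ‖∑ k ∈ s, v k * expMode k x‖ ^ 2 : ℝ) : ℂ)
  simp only [hpt]
  rw [integral_finsetSum s fun k _ => integrable_finsetSum s fun l _ => hI k l]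
  refine Finset.sum_congr rfl fun k _ => ?_
  rw [integral_finsetSum s fun l _ => hI k l]
  refine Finset.sum_congr rfl fun l _ => ?_
  rw [integral_const_mul, torusCoeff]
  ring

lemma torusIntegral_normSq_sum (s : Finset (Fin d → ℤ)) (v : (Fin d → ℤ) → ℂ) :
    torusIntegral (fun x => ‖∑ k ∈ s, v k * expMode k x‖ ^ 2) = ∑ k ∈ s, ‖v k‖ ^ 2 := by
  have h := sum_torusCoeff_sub (IsTorusSmooth.const 1) s v
  simp only [one_mul] at h
  rw [← Complex.ofReal_inj, ← h, Complex.ofReal_sum]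
  refine Finset.sum_congr rfl fun k hk => ?_
  rw [Finset.sum_eq_single_of_mem k hk]
  · rw [sub_self, torusCoeff_zero, torusIntegral_const]
    push_cast
    rw [← Complex.conj_mul', Complex.star_def]
    ring
  · intro l _ hl
    rw [torusCoeff_one_of_ne (sub_ne_zero.2 hl.symm)]
    ring

/-- Toeplitz forms of positive symbols are bounded below. -/
lemma le_sum_torusCoeff_sub (hρ : IsTorusSmooth ρ) {m : ℝ} (hm : ∀ x, m ≤ ρ x)
    (s : Finset (Fin d → ℤ)) (v : (Fin d → ℤ) → ℂ) :
    m * ∑ k ∈ s, ‖v k‖ ^ 2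
      ≤ (∑ k ∈ s, ∑ l ∈ s, star (v k) * torusCoeff ρ (k - l) * v l).re := by
  rw [sum_torusCoeff_sub hρ, Complex.ofReal_re, ← torusIntegral_normSq_sum,
    ← torusIntegral_const_mul]
  have hc : Continuous fun x => ‖∑ k ∈ s, v k * expMode k x‖ ^ 2 := by
    have := fun k : Fin d → ℤ => continuous_expMode k
    fun_prop
  refine setIntegral_mono_on
    ((continuous_const.mul hc).continuousOn.integrableOn_compact isCompact_Icc)
    ((hρ.continuous.mul hc).continuousOn.integrableOn_compact isCompact_Icc) measurableSet_Icc
    fun x _ => ?_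
  gcongr
  exact hm x

end FourierCoefficients

end TransportHessian

namespace TransportHessian

/-! ### Solvability of the weighted Poisson equation. -/

section Existence

variable {d : ℕ} {f g ρ σ : (Fin d → ℝ) → ℝ}

/-- The real part of a Fourier mode. -/
noncomputable def cosMode (k : Fin d → ℤ) (x : Fin d → ℝ) : ℝ := Real.cos (phase k x)

/-- The imaginary part of a Fourier mode. -/
noncomputable def sinMode (k : Fin d → ℤ) (x : Fin d → ℝ) : ℝ := Real.sin (phase k x)

lemma expMode_eq (k : Fin d → ℤ) (x : Fin d → ℝ) :
    expMode k x = cosMode k x + sinMode k x * Complex.I := by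
  rw [expMode, Complex.exp_mul_I, cosMode, sinMode, Complex.ofReal_cos, Complex.ofReal_sin]

lemma expMode_neg_eq (k : Fin d → ℤ) (x : Fin d → ℝ) :
    expMode (-k) x = cosMode k x - sinMode k x * Complex.I := by
  rw [expMode_eq, cosMode, sinMode, phase_neg, Real.cos_neg, Real.sin_neg, cosMode, sinMode]
  push_cast
  ring

lemma isTorusSmooth_cosMode (k : Fin d → ℤ) : IsTorusSmooth (cosMode k) := by
  refine ⟨Real.contDiff_cos.comp (phase k).contDiff, fun x m => ?_⟩
  simpa [expMode_eq] using congrArg Complex.re (expMode_periodic k x m)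

lemma isTorusSmooth_sinMode (k : Fin d → ℤ) : IsTorusSmooth (sinMode k) := by
  refine ⟨Real.contDiff_sin.comp (phase k).contDiff, fun x m => ?_⟩
  simpa [expMode_eq] using congrArg Complex.im (expMode_periodic k x m)

lemma pd_cosMode (k : Fin d → ℤ) (i : Fin d) :
    pd i (cosMode k) = fun x => -(2 * Real.pi * k i) * sinMode k x := by
  ext x
  have h := (phase k).hasFDerivAt (x := x)
  rw [pd, show cosMode k = fun x => Real.cos (phase k x) from rfl, h.cos.fderiv]
  simp [phase_single, sinMode]
  ring

lemma pd_sinMode (k : Fin d → ℤ) (i : Fin d) :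
    pd i (sinMode k) = fun x => 2 * Real.pi * k i * cosMode k x := by
  ext x
  have h := (phase k).hasFDerivAt (x := x)
  rw [pd, show sinMode k = fun x => Real.sin (phase k x) from rfl, h.sin.fderiv]
  simp [phase_single, cosMode]
  ring

/-- The weighted Laplacian of a conjugate Fourier mode. -/
noncomputable def wLapMode (ρ : (Fin d → ℝ) → ℝ) (k : Fin d → ℤ) (x : Fin d → ℝ) : ℂ :=
  wLap ρ (cosMode k) x - wLap ρ (sinMode k) x * Complex.I

lemma wLapMode_eq (hρ : IsTorusSmooth ρ) (k : Fin d → ℤ) (x : Fin d → ℝ) :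
    wLapMode ρ k x = -(4 * Real.pi ^ 2 * freqSq k : ℝ) * ((ρ x : ℂ) * expMode (-k) x)
      - ∑ i, 2 * Real.pi * k i * Complex.I * ((pd i ρ x : ℂ) * expMode (-k) x) := by
  have hc : laplacian (cosMode k) x = -(4 * Real.pi ^ 2 * freqSq k) * cosMode k x := by
    simp only [laplacian, pd_cosMode, pd_const_mul (isTorusSmooth_sinMode k), pd_sinMode, freqSq,
      Finset.mul_sum, ← Finset.sum_neg_distrib, Finset.sum_mul]
    exact Finset.sum_congr rfl fun i _ => by ring
  have hs : laplacian (sinMode k) x = -(4 * Real.pi ^ 2 * freqSq k) * sinMode k x := by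
    simp only [laplacian, pd_sinMode, pd_const_mul (isTorusSmooth_cosMode k), pd_cosMode, freqSq,
      Finset.mul_sum, ← Finset.sum_neg_distrib, Finset.sum_mul]
    exact Finset.sum_congr rfl fun i _ => by ring
  have hg : (gradInner ρ (cosMode k) x : ℂ) - gradInner ρ (sinMode k) x * Complex.I
      = -∑ i, 2 * Real.pi * k i * Complex.I * ((pd i ρ x : ℂ) * expMode (-k) x) := by
    simp only [gradInner, pd_cosMode, pd_sinMode, expMode_neg_eq]
    push_cast
    rw [Finset.sum_mul, ← Finset.sum_sub_distrib, ← Finset.sum_neg_distrib]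
    refine Finset.sum_congr rfl fun i _ => ?_
    linear_combination (-2 * Real.pi * k i * pd i ρ x * sinMode k x : ℂ) * Complex.I_sq
  rw [wLapMode, wLap_expand hρ (isTorusSmooth_cosMode k), wLap_expand hρ (isTorusSmooth_sinMode k),
    hc, hs, sub_eq_add_neg _ (∑ i, _), ← hg, expMode_neg_eq]
  push_cast
  ring

lemma continuous_wLapMode (hρ : IsTorusSmooth ρ) (k : Fin d → ℤ) : Continuous (wLapMode ρ k) := by
  have hc := (hρ.wLap (isTorusSmooth_cosMode k)).continuous
  have hs := (hρ.wLap (isTorusSmooth_sinMode k)).continuous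
  unfold wLapMode
  fun_prop

/-- The matrix entries of ∇·(ρ∇): the Laplacian contributes |k|², the gradient of ρ contributes
k·(k-l), and their difference is k·l. -/
lemma setIntegral_expMode_mul_wLapMode (hρ : IsTorusSmooth ρ) (k l : Fin d → ℤ) :
    ∫ x in Icc (0 : Fin d → ℝ) 1, expMode l x * wLapMode ρ k x
      = -(4 * Real.pi ^ 2 * ∑ i, (k i : ℂ) * l i) * torusCoeff ρ (k - l) := by
  have hpt : ∀ x, expMode l x * wLapMode ρ k x
      = -(4 * Real.pi ^ 2 * freqSq k : ℝ) * ((ρ x : ℂ) * expMode (-(k - l)) x)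
      - ∑ i, 2 * Real.pi * k i * Complex.I * ((pd i ρ x : ℂ) * expMode (-(k - l)) x) := fun x => by
    rw [wLapMode_eq hρ, neg_sub, sub_eq_add_neg l k, expMode_add, mul_sub, Finset.mul_sum]
    congr 1
    · ring
    · exact Finset.sum_congr rfl fun i _ => by ring
  simp only [hpt]
  rw [integral_sub ((integrableOn_mul_expMode hρ _).const_mul _)
    (integrable_finsetSum _ fun i _ => (integrableOn_mul_expMode (hρ.pd i) _).const_mul _),
    integral_finsetSum _ fun i _ => (integrableOn_mul_expMode (hρ.pd i) _).const_mul _]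
  simp only [integral_const_mul]
  change _ * torusCoeff ρ (k - l) - ∑ i, _ * torusCoeff (pd i ρ) (k - l) = _
  simp only [torusCoeff_pd hρ, freqSq]
  push_cast
  rw [Finset.mul_sum, Finset.mul_sum, ← Finset.sum_neg_distrib, ← Finset.sum_neg_distrib,
    Finset.sum_mul, Finset.sum_mul, ← Finset.sum_sub_distrib]
  refine Finset.sum_congr rfl fun i _ => ?_
  simp only [Pi.sub_apply, Int.cast_sub]
  linear_combination (-4 * Real.pi ^ 2 * k i * (k i - l i) * torusCoeff ρ (k - l)) * Complex.I_sq

/-- Symmetry of the weighted Laplacian, tested against a Fourier mode. -/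
lemma setIntegral_mul_wLapMode (hρ : IsTorusSmooth ρ) (hf : IsTorusSmooth f) (k : Fin d → ℤ) :
    ∫ x in Icc (0 : Fin d → ℝ) 1, (f x : ℂ) * wLapMode ρ k x = torusCoeff (wLap ρ f) k := by
  have key : ∀ {F C S : (Fin d → ℝ) → ℝ}, IsTorusSmooth F → IsTorusSmooth C → IsTorusSmooth S →
      ∫ x in Icc (0 : Fin d → ℝ) 1, (F x : ℂ) * ((C x : ℂ) - S x * Complex.I)
        = (torusIntegral (fun x => F x * C x) : ℂ)
          - torusIntegral (fun x => F x * S x) * Complex.I := by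
    intro F C S hF hC hS
    have h1 : ∀ x, (F x : ℂ) * ((C x : ℂ) - S x * Complex.I)
        = ((F x * C x : ℝ) : ℂ) - ((F x * S x : ℝ) : ℂ) * Complex.I := fun x => by
      push_cast; ring
    simp only [h1]
    rw [integral_sub (hF.mul hC).integrableOn.ofReal
      ((hF.mul hS).integrableOn.ofReal.mul_const _), integral_mul_const, integral_complex_ofReal,
      integral_complex_ofReal]
    rfl
  have hc := isTorusSmooth_cosMode k
  have hs := isTorusSmooth_sinMode k
  simp only [torusCoeff, expMode_neg_eq]
  rw [key (hρ.wLap hf) hc hs]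
  refine (key hf (hρ.wLap hc) (hρ.wLap hs)).trans ?_
  rw [torusIntegral_mul_wLap_comm hf hρ hc, torusIntegral_mul_wLap_comm hf hρ hs]
  simp only [mul_comm (wLap ρ f _)]

/-- Unit direction vectors of frequencies; the zero frequency gets a direction of its own. -/
noncomputable def freqDir (a : Option (Fin d)) (k : Fin d → ℤ) : ℝ :=
  a.elim (if k = 0 then 1 else 0) fun i => k i / √(freqSq k)

lemma sum_freqDir_sq (k : Fin d → ℤ) : ∑ a, freqDir a k ^ 2 = 1 := by
  rw [Fintype.sum_option]
  simp only [freqDir, Option.elim]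
  by_cases hk : k = 0
  · simp [hk]
  · have hq : 0 < freqSq k := zero_lt_one.trans_le (freqSq_pos hk)
    simp only [hk, if_false, div_pow, Real.sq_sqrt hq.le, ← Finset.sum_div]
    change 0 ^ 2 + freqSq k / freqSq k = 1
    rw [div_self hq.ne']
    norm_num

lemma abs_sum_freqDir_le (k l : Fin d → ℤ) : |∑ a, freqDir a k * freqDir a l| ≤ 1 := by
  have h : ∑ a, (freqDir a k ^ 2 + freqDir a l ^ 2) / 2 = 1 := by
    rw [← Finset.sum_div, Finset.sum_add_distrib, sum_freqDir_sq, sum_freqDir_sq]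
    norm_num
  rw [← h]
  refine (Finset.abs_sum_le_sum_abs _ _).trans (Finset.sum_le_sum fun a _ => ?_)
  exact abs_le.2 ⟨by nlinarith [sq_nonneg (freqDir a k + freqDir a l)],
    by nlinarith [sq_nonneg (freqDir a k - freqDir a l)]⟩

lemma sum_freqDir_of_ne {k : Fin d → ℤ} (hk : k ≠ 0) (l : Fin d → ℤ) :
    √(freqSq k) * ∑ a, freqDir a k * freqDir a l = (∑ i, (k i : ℝ) * l i) / √(freqSq l) := by
  have hq : 0 < √(freqSq k) := Real.sqrt_pos.2 (zero_lt_one.trans_le (freqSq_pos hk))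
  rw [Fintype.sum_option]
  simp only [freqDir, Option.elim, hk, if_false, zero_mul, zero_add, Finset.mul_sum,
    Finset.sum_div]
  refine Finset.sum_congr rfl fun i _ => ?_
  field_simp

/-- The Fourier coefficients of the solution of `∇·(ρ∇Φ) = σ`. -/
lemma exists_potential_coeff (hρ : ρ ∈ densities d) (hσ : σ ∈ tangent d) :
    ∃ φ : (Fin d → ℤ) → ℂ, RapidDecay φ ∧ ∀ k, HasSum (fun l =>
      φ l * (-(4 * Real.pi ^ 2 * ∑ i, (k i : ℂ) * l i) * torusCoeff ρ (k - l)))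
      (torusCoeff σ k) := by
  obtain ⟨m, hm, hmρ⟩ := hρ.1.exists_pos_le hρ.2.2
  have hpi := Real.pi_gt_three
  -- Dividing by |k| and using |l|φ(l) as unknown turns k·l into a product of unit directions. At `k
  -- = 0` the quotient is 0/0 = 0, consistent with σ having zero mean.
  set h : (Fin d → ℤ) → ℂ := fun k =>
    -(torusCoeff σ k / ((4 * Real.pi ^ 2 * √(freqSq k) : ℝ) : ℂ)) with hh
  have hσ0 : torusCoeff σ 0 = 0 := by rw [torusCoeff_zero, hσ.2, Complex.ofReal_zero]
  have hhr : RapidDecay h := fun N => by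
    obtain ⟨C, hC⟩ := rapidDecay_torusCoeff hσ.1 N
    refine ⟨C, fun k => le_trans ?_ (hC k)⟩
    have hq := freqSq_nonneg k
    gcongr
    by_cases hk : k = 0
    · simp [hh, hk, hσ0]
    · have h1 : 1 ≤ √(freqSq k) := Real.one_le_sqrt.2 (freqSq_pos hk)
      have h2 : 1 ≤ 4 * Real.pi ^ 2 * √(freqSq k) := by
        have : 1 ≤ 4 * Real.pi ^ 2 := by nlinarith
        nlinarith
      rw [hh, norm_neg, norm_div, Complex.norm_real, Real.norm_of_nonneg (by positivity)]
      exact div_le_self (norm_nonneg _) h2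
  obtain ⟨x, hx, hsol⟩ := exists_rapidDecay_solution
    (K := fun k l => torusCoeff ρ (k - l) * ((∑ a, freqDir a k * freqDir a l : ℝ) : ℂ))
    (rapidDecay_torusCoeff hρ.1) hhr
    (fun k l => by
      rw [norm_mul, Complex.norm_real]
      exact mul_le_of_le_one_right (norm_nonneg _) (abs_sum_freqDir_le k l))
    -- The form is the sum over directions `a` of Toeplitz forms of `freqDir a · v`; the squared
    -- directions sum to one, zero frequency included, so the lower bound `m` survives.
    hm (fun s v => by
      have h1 := Finset.sum_le_sum fun (a : Option (Fin d)) (_ : a ∈ Finset.univ) =>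
        le_sum_torusCoeff_sub hρ.1 hmρ s fun k => (freqDir a k : ℂ) * v k
      refine (Eq.trans_le ?_ h1).trans_eq ?_
      · rw [← Finset.mul_sum, Finset.sum_comm]
        congr 1
        refine Finset.sum_congr rfl fun k _ => ?_
        simp only [norm_mul, Complex.norm_real, mul_pow, Real.norm_eq_abs, sq_abs]
        rw [← Finset.sum_mul, sum_freqDir_sq, one_mul]
      · rw [← Complex.re_sum, Finset.sum_comm]
        congr 1
        refine Finset.sum_congr rfl fun k _ => ?_
        rw [Finset.sum_comm]
        refine Finset.sum_congr rfl fun l _ => ?_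
        push_cast
        rw [Finset.mul_sum, Finset.mul_sum, Finset.sum_mul]
        refine Finset.sum_congr rfl fun a _ => ?_
        rw [star_mul', Complex.star_def, Complex.conj_ofReal]
        ring)
  refine ⟨fun l => x l / (√(freqSq l) : ℝ), fun N => ?_, fun k => ?_⟩
  · obtain ⟨C, hC⟩ := hx N
    refine ⟨C, fun k => le_trans ?_ (hC k)⟩
    have hq := freqSq_nonneg k
    gcongr
    by_cases hk : k = 0
    · simp [hk, freqSq]
    · rw [norm_div, Complex.norm_real, Real.norm_of_nonneg (by positivity)]
      exact div_le_self (norm_nonneg _) (Real.one_le_sqrt.2 (freqSq_pos hk))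
  · by_cases hk : k = 0
    · subst hk
      simp [hσ0]
    · have hq : √(freqSq k) ≠ 0 :=
        (Real.sqrt_pos.2 (zero_lt_one.trans_le (freqSq_pos hk))).ne'
      have h1 := (hsol k).mul_left (-(4 * Real.pi ^ 2 * √(freqSq k) : ℝ) : ℂ)
      have hne : ((4 * Real.pi ^ 2 * √(freqSq k) : ℝ) : ℂ) ≠ 0 := by
        have : 0 < Real.pi := by positivity
        exact_mod_cast mul_ne_zero (by positivity) hq
      have hhk : torusCoeff σ k = -(4 * Real.pi ^ 2 * √(freqSq k) : ℝ) * h k := by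
        rw [hh]
        field_simp
      rw [hhk]
      refine h1.congr_fun fun l => ?_
      have h2 := congrArg (fun r : ℝ => (r : ℂ)) (sum_freqDir_of_ne hk l)
      simp only [Complex.ofReal_mul, Complex.ofReal_div] at h2
      have h3 : ((∑ i, (k i : ℝ) * l i : ℝ) : ℂ) = ∑ i, (k i : ℂ) * l i := by push_cast; rfl
      rw [h3] at h2
      push_cast at h2 ⊢
      linear_combination (4 * Real.pi ^ 2 * torusCoeff ρ (k - l) * x l : ℂ) * h2

/-- **Solvability of the weighted Poisson equation** `∇·(ρ∇Φ) = σ` on the torus. -/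
theorem exists_wLap_eq (hρ : ρ ∈ densities d) (hσ : σ ∈ tangent d) :
    ∃ Φ, IsTorusSmooth Φ ∧ wLap ρ Φ = σ := by
  obtain ⟨φ, hφ, hsol⟩ := exists_potential_coeff hρ hσ
  set u : (Fin d → ℝ) → ℂ := fun x => ∑' k, φ k * expMode k x with hu
  have hus : ContDiff ℝ ∞ u := hφ.contDiff_tsum
  have hup : ∀ (x : Fin d → ℝ) (m : Fin d → ℤ), u (x + fun i => (m i : ℝ)) = u x :=
    fun x m => by simp only [hu, expMode_periodic]
  have hΦ : IsTorusSmooth fun x => (u x).re :=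
    ⟨Complex.reCLM.contDiff.comp hus, fun x m => by rw [hup]⟩
  have hΨ : IsTorusSmooth fun x => (u x).im :=
    ⟨Complex.imCLM.contDiff.comp hus, fun x m => by rw [hup]⟩
  -- All derivatives fall on the test mode, so the series for `u` is only integrated term by term,
  -- never differentiated.
  have hweak : ∀ k, ∫ x in Icc (0 : Fin d → ℝ) 1, u x * wLapMode ρ k x = torusCoeff σ k := by
    intro k
    have hcont := continuous_wLapMode hρ.1 k
    obtain ⟨M, hM⟩ := isCompact_Icc.exists_bound_of_continuousOn
      (s := Icc (0 : Fin d → ℝ) 1) hcont.continuousOn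
    have hI : ∀ l, IntegrableOn (fun x => φ l * (expMode l x * wLapMode ρ k x))
        (Icc (0 : Fin d → ℝ) 1) := fun l =>
      (continuous_const.mul ((continuous_expMode l).mul
        hcont)).continuousOn.integrableOn_compact isCompact_Icc
    have hsum : Summable fun l => ∫ x in Icc (0 : Fin d → ℝ) 1,
        ‖φ l * (expMode l x * wLapMode ρ k x)‖ := by
      refine Summable.of_nonneg_of_le (fun l => integral_nonneg fun x => norm_nonneg _)
        (fun l => ?_) (hφ.summable_norm.mul_right M)
      have h1 := norm_setIntegral_le_of_norm_le_const (μ := volume) (s := Icc (0 : Fin d → ℝ) 1)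
        (f := fun x => ‖φ l * (expMode l x * wLapMode ρ k x)‖) (C := ‖φ l‖ * M)
        isCompact_Icc.measure_lt_top fun x hx => by
          rw [norm_norm, norm_mul, norm_mul, norm_expMode, one_mul]
          exact mul_le_mul_of_nonneg_left (hM x hx) (norm_nonneg _)
      rw [volume_cell, mul_one] at h1
      exact (le_abs_self _).trans h1
    have h2 := hasSum_integral_of_summable_integral_norm hI hsum
    simp only [integral_const_mul, setIntegral_expMode_mul_wLapMode hρ.1] at h2
    rw [(hsol k).unique h2]
    refine setIntegral_congr_fun measurableSet_Icc fun x _ => ?_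
    simp only [hu, ← mul_assoc]
    rw [tsum_mul_right]
  refine ⟨_, hΦ, funext fun x => ?_⟩
  have hcoef : ∀ k, torusCoeff (wLap ρ fun x => (u x).re) k
      + torusCoeff (wLap ρ fun x => (u x).im) k * Complex.I = torusCoeff σ k := fun k => by
    rw [← hweak k, ← setIntegral_mul_wLapMode hρ.1 hΦ, ← setIntegral_mul_wLapMode hρ.1 hΨ,
      ← integral_mul_const, ← integral_add]
    · congr 1
      ext x
      conv_rhs => rw [← Complex.re_add_im (u x)]
      ring
    · exact ((Complex.continuous_ofReal.comp hΦ.continuous).mul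
        (continuous_wLapMode hρ.1 k)).continuousOn.integrableOn_compact isCompact_Icc
    · exact (((Complex.continuous_ofReal.comp hΨ.continuous).mul
        (continuous_wLapMode hρ.1 k)).mul
          continuous_const).continuousOn.integrableOn_compact isCompact_Icc
  have hΦw := hρ.1.wLap hΦ
  have hΨw := hρ.1.wLap hΨ
  have hzero := eq_zero_of_forall_setIntegral_mul_expMode
    (g := fun x => ((wLap ρ (fun x => (u x).re) x : ℝ) : ℂ)
      + (wLap ρ (fun x => (u x).im) x : ℝ) * Complex.I - (σ x : ℂ))
    (by
      have h1 := hΦw.continuous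
      have h2 := hΨw.continuous
      have h3 := hσ.1.continuous
      fun_prop)
    (fun x k => by rw [hΦw.periodic, hΨw.periodic, hσ.1.periodic])
    (fun k => by
      have h1 := integrableOn_mul_expMode hΦw k
      have h2 := (integrableOn_mul_expMode hΨw k).mul_const Complex.I
      have h12 : IntegrableOn (fun x => (wLap ρ (fun x => (u x).re) x : ℂ) * expMode k x
          + (wLap ρ (fun x => (u x).im) x : ℂ) * expMode k x * Complex.I)
          (Icc (0 : Fin d → ℝ) 1) := h1.add h2
      have h3 := integrableOn_mul_expMode hσ.1 k
      have h4 := hcoef (-k)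
      simp only [torusCoeff, neg_neg] at h4
      rw [← sub_eq_zero, ← integral_mul_const, ← integral_add h1 h2,
        ← integral_sub h12 h3] at h4
      rw [← h4]
      congr 1
      ext x
      ring) x
  -- Since ρ and σ are real, the real part of the complex solution already solves the equation.
  have := congrArg Complex.re hzero
  simp at this
  linarith

end Existence

end TransportHessian

namespace TransportHessian

/-! ### The two metrics in terms of potentials, and their gradients. -/

section Metric

variable {d : ℕ} {a f g ρ σ τ Θ Φ Ψ : (Fin d → ℝ) → ℝ}

lemma pd_add_const (hf : IsTorusSmooth f) (c : ℝ) (i : Fin d) :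
    pd i (fun y => f y + c) = pd i f := by
  ext x; rw [pd_add hf (.const c), pd_const, add_zero]

lemma gradInner_add_const (hf : IsTorusSmooth f) (hg : IsTorusSmooth g) (b c : ℝ) :
    gradInner (fun y => f y + b) (fun y => g y + c) = gradInner f g := by
  ext x; simp only [gradInner, pd_add_const hf, pd_add_const hg]

lemma wLap_add_const (hf : IsTorusSmooth f) (c : ℝ) : wLap a (fun y => f y + c) = wLap a f := by
  ext x; simp only [wLap, pd_add_const hf]

lemma gradInner_log (hρ : ρ ∈ densities d) (f : (Fin d → ℝ) → ℝ) (x : Fin d → ℝ) :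
    ρ x * gradInner (fun y => Real.log (ρ y)) f x = gradInner ρ f x := by
  have hx := (hρ.2.2 x).ne'
  simp only [gradInner, pd_log hρ.1 (fun x => (hρ.2.2 x).ne'), Finset.mul_sum]
  refine Finset.sum_congr rfl fun i _ => ?_
  field_simp

lemma wLap_log (hρ : ρ ∈ densities d) : wLap ρ (fun y => Real.log (ρ y)) = laplacian ρ := by
  ext x
  simp only [wLap, laplacian]
  refine Finset.sum_congr rfl fun i _ => ?_
  congr 1
  ext y
  have hy := (hρ.2.2 y).ne'
  rw [pd_log hρ.1 fun x => (hρ.2.2 x).ne']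
  field_simp

lemma gradInner_neg_right (f g : (Fin d → ℝ) → ℝ) (x : Fin d → ℝ) :
    gradInner f (fun y => -g y) x = -gradInner f g x := by
  simp only [gradInner, pd_neg, mul_neg, Finset.sum_neg_distrib]

lemma gradInner_sub_right (hg : IsTorusSmooth g) (hf : IsTorusSmooth f) (h : (Fin d → ℝ) → ℝ)
    (x : Fin d → ℝ) :
    gradInner h (fun y => g y - f y) x = gradInner h g x - gradInner h f x := by
  simp only [gradInner, pd_sub hg hf, mul_sub, Finset.sum_sub_distrib]

/-- Makes the additive constant left free in the first variation harmless. -/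
lemma torusIntegral_first_mul_wLap (hf : IsTorusSmooth f) (ha : IsTorusSmooth a)
    (hg : IsTorusSmooth g) (c : ℝ) :
    torusIntegral (fun x => (f x + c) * wLap a g x)
      = -torusIntegral (fun x => a x * gradInner f g x) := by
  have h := gradInner_add_const hf hg c 0
  simp only [add_zero] at h
  rw [torusIntegral_mul_wLap (hf.add (.const c)) ha hg, h]

lemma transportMetric_wLap (hρ : ρ ∈ densities d) (hσ : σ ∈ tangent d) (hΨ : IsTorusSmooth Ψ) :
    transportMetric ρ σ (wLap ρ Ψ) = -torusIntegral fun x => Ψ x * σ x := by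
  obtain ⟨c, hc⟩ := invWLap_wLap hρ hΨ
  rw [transportMetric, hc]
  have : (fun x => σ x * -(Ψ x + c)) = fun x => -(Ψ x * σ x) - c * σ x := by
    ext x; ring
  rw [this, torusIntegral_sub (hΨ.mul hσ.1).neg (hσ.1.const_mul c), torusIntegral_neg,
    torusIntegral_const_mul, hσ.2, mul_zero, sub_zero]

/-- The integrand of the transport Hessian metric of the entropy in terms of potentials. -/
noncomputable def hessianIntegrand (ρ Φ Ψ : (Fin d → ℝ) → ℝ) (x : Fin d → ℝ) : ℝ :=
  wLap ρ Φ x * wLap ρ Ψ x / ρ x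
    - 1 / 2 * (wLap ρ Φ x * gradInner (fun y => Real.log (ρ y)) Ψ x
      + wLap ρ Ψ x * gradInner (fun y => Real.log (ρ y)) Φ x
      - gradInner Φ Ψ x * laplacian ρ x)

lemma isTorusSmooth_hessianIntegrand (hρ : ρ ∈ densities d) (hΦ : IsTorusSmooth Φ)
    (hΨ : IsTorusSmooth Ψ) : IsTorusSmooth (hessianIntegrand ρ Φ Ψ) := by
  have hne := fun x => (hρ.2.2 x).ne'
  have hL := hρ.1.log hne
  exact (((hρ.1.wLap hΦ).mul (hρ.1.wLap hΨ)).div hρ.1 hne).sub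
    (((((hρ.1.wLap hΦ).mul (hL.gradInner hΨ)).add ((hρ.1.wLap hΨ).mul (hL.gradInner hΦ))).sub
      ((hΦ.gradInner hΨ).mul hρ.1.laplacian)).const_mul _)

lemma christoffel_wLap (hρ : ρ ∈ densities d) (hΦ : IsTorusSmooth Φ) (hΨ : IsTorusSmooth Ψ)
    (x : Fin d → ℝ) :
    christoffel ρ (wLap ρ Φ) (wLap ρ Ψ) x = -(1 / 2) * (wLap (wLap ρ Φ) Ψ x
      + wLap (wLap ρ Ψ) Φ x + wLap ρ (gradInner Φ Ψ) x) := by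
  obtain ⟨b, hb⟩ := invWLap_wLap hρ hΦ
  obtain ⟨c, hc⟩ := invWLap_wLap hρ hΨ
  rw [christoffel, hb, hc, wLap_add_const hΦ, wLap_add_const hΨ, gradInner_add_const hΦ hΨ]

/-- Each term of the Christoffel symbol is a divergence, so pairing with log ρ moves a gradient onto
log ρ; in the last term ρ∇log ρ = ∇ρ then produces Δρ. -/
lemma hessianMetric_wLap (hρ : ρ ∈ densities d) (hΦ : IsTorusSmooth Φ) (hΨ : IsTorusSmooth Ψ) :
    hessianMetric entropy ρ (wLap ρ Φ) (wLap ρ Ψ) = torusIntegral (hessianIntegrand ρ Φ Ψ) := by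
  have hne := fun x => (hρ.2.2 x).ne'
  have hL := hρ.1.log hne
  have hσ := hρ.1.wLap hΦ
  have hτ := hρ.1.wLap hΨ
  have hX := hΦ.gradInner hΨ
  obtain ⟨c, hc⟩ := firstVariation_entropy hρ
  have hLc := hL.add (.const c)
  have hswap : torusIntegral (fun x => ρ x * gradInner (fun y => Real.log (ρ y)) (gradInner Φ Ψ) x)
      = -torusIntegral fun x => gradInner Φ Ψ x * laplacian ρ x := by
    rw [gradInner_comm, ← wLap_log hρ, torusIntegral_mul_wLap hX hρ.1 hL, neg_neg]
  have hΓ : (torusIntegral fun x => firstVariation entropy ρ x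
        * christoffel ρ (wLap ρ Φ) (wLap ρ Ψ) x)
      = 1 / 2 * torusIntegral fun x => wLap ρ Φ x * gradInner (fun y => Real.log (ρ y)) Ψ x
      + wLap ρ Ψ x * gradInner (fun y => Real.log (ρ y)) Φ x
      - gradInner Φ Ψ x * laplacian ρ x := by
    have : (fun x => firstVariation entropy ρ x * christoffel ρ (wLap ρ Φ) (wLap ρ Ψ) x)
        = fun x => -(1 / 2) * ((Real.log (ρ x) + c) * wLap (wLap ρ Φ) Ψ x
          + (Real.log (ρ x) + c) * wLap (wLap ρ Ψ) Φ x
          + (Real.log (ρ x) + c) * wLap ρ (gradInner Φ Ψ) x) := by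
      ext x
      rw [hc, christoffel_wLap hρ hΦ hΨ]
      ring
    rw [this, torusIntegral_const_mul,
      torusIntegral_add ((hLc.mul (hσ.wLap hΨ)).add (hLc.mul (hτ.wLap hΦ)))
        (hLc.mul (hρ.1.wLap hX)),
      torusIntegral_add (hLc.mul (hσ.wLap hΨ)) (hLc.mul (hτ.wLap hΦ)),
      torusIntegral_first_mul_wLap hL hσ hΨ, torusIntegral_first_mul_wLap hL hτ hΦ,
      torusIntegral_first_mul_wLap hL hρ.1 hX, hswap,
      torusIntegral_sub ((hσ.mul (hL.gradInner hΨ)).add (hτ.mul (hL.gradInner hΦ)))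
        (hX.mul hρ.1.laplacian),
      torusIntegral_add (hσ.mul (hL.gradInner hΨ)) (hτ.mul (hL.gradInner hΦ))]
    ring
  rw [hessianMetric, secondVariation_entropy hρ (wLap_mem_tangent hρ.1 hΦ)
    (wLap_mem_tangent hρ.1 hΨ), hΓ, ← torusIntegral_const_mul,
    ← torusIntegral_sub ((hσ.mul hτ).div hρ.1 hne)
      ((((hσ.mul (hL.gradInner hΨ)).add (hτ.mul (hL.gradInner hΦ))).sub
        (hX.mul hρ.1.laplacian)).const_mul _)]
  rfl

/-- **Bochner's formula** in the form used for the Hessian of the entropy. -/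
lemma laplacian_gradInner_self (hΦ : IsTorusSmooth Φ) (x : Fin d → ℝ) :
    laplacian (gradInner Φ Φ) x
      = 2 * ∑ i, ∑ j, pd j (pd i Φ) x ^ 2 + 2 * gradInner (laplacian Φ) Φ x := by
  have h1 : ∀ j, pd j (gradInner Φ Φ) = fun y => 2 * ∑ i, pd i Φ y * pd j (pd i Φ) y := fun j => by
    ext y
    unfold gradInner
    rw [pd_sum fun i _ => (hΦ.pd i).mul (hΦ.pd i), Finset.mul_sum]
    refine Finset.sum_congr rfl fun i _ => ?_
    rw [pd_mul (hΦ.pd i) (hΦ.pd i)]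
    ring
  have h2 : ∀ j, pd j (pd j (gradInner Φ Φ)) x = 2 * ∑ i, pd j (pd i Φ) x ^ 2
      + 2 * ∑ i, pd i (pd j (pd j Φ)) x * pd i Φ x := fun j => by
    rw [h1, pd_const_mul (.sum fun i _ => (hΦ.pd i).mul ((hΦ.pd i).pd j)),
      pd_sum fun i _ => (hΦ.pd i).mul ((hΦ.pd i).pd j), ← mul_add, ← Finset.sum_add_distrib]
    congr 1
    refine Finset.sum_congr rfl fun i _ => ?_
    have hc : pd j (pd i Φ) = pd i (pd j Φ) := funext fun y => pd_comm hΦ j i y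
    rw [pd_mul (hΦ.pd i) ((hΦ.pd i).pd j), pd_comm (hΦ.pd j) i j, ← hc]
    ring
  simp only [laplacian, h2, Finset.sum_add_distrib, ← Finset.mul_sum]
  congr 2
  · exact Finset.sum_comm
  · rw [Finset.sum_comm]
    refine Finset.sum_congr rfl fun i _ => ?_
    have := pd_sum (fun j (_ : j ∈ Finset.univ) => (hΦ.pd j).pd j) i x
    rw [← Finset.sum_mul, ← this]
    rfl

/-- The transport Hessian metric of the entropy is the weighted `L²` norm of the Hessian of the
potential. -/
lemma hessianMetric_wLap_self (hρ : ρ ∈ densities d) (hΦ : IsTorusSmooth Φ) :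
    hessianMetric entropy ρ (wLap ρ Φ) (wLap ρ Φ)
      = torusIntegral fun x => ρ x * ∑ i, ∑ j, pd j (pd i Φ) x ^ 2 := by
  have hX := hΦ.gradInner hΦ
  have hσ := hρ.1.wLap hΦ
  have hpt : hessianIntegrand ρ Φ Φ
      = fun x => laplacian Φ x * wLap ρ Φ x + 1 / 2 * (gradInner Φ Φ x * laplacian ρ x) := by
    ext x
    have hx := (hρ.2.2 x).ne'
    have h1 : wLap ρ Φ x / ρ x = laplacian Φ x + gradInner (fun y => Real.log (ρ y)) Φ x := by
      rw [wLap_expand hρ.1 hΦ, ← gradInner_log hρ]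
      field_simp
    rw [hessianIntegrand, mul_div_assoc, h1]
    ring
  have hHess : IsTorusSmooth fun x => ∑ i, ∑ j, pd j (pd i Φ) x ^ 2 := by
    simp only [sq]
    exact .sum fun i _ => .sum fun j _ => ((hΦ.pd i).pd j).mul ((hΦ.pd i).pd j)
  -- Moving the Laplacian from ρ to |∇Φ|² brings in Bochner's formula; its ∇ΔΦ·∇Φ term cancels the
  -- one from integrating ΔΦ ∇·(ρ∇Φ) by parts.
  have hswap := torusIntegral_mul_wLap_comm hX (.const 1) hρ.1
  simp only [wLap_one] at hswap
  rw [hessianMetric_wLap hρ hΦ hΦ, hpt, torusIntegral_add (hΦ.laplacian.mul hσ)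
    ((hX.mul hρ.1.laplacian).const_mul _), torusIntegral_const_mul, hswap,
    torusIntegral_mul_wLap hΦ.laplacian hρ.1 hΦ]
  have : (fun x => ρ x * laplacian (gradInner Φ Φ) x) = fun x =>
      2 * (ρ x * ∑ i, ∑ j, pd j (pd i Φ) x ^ 2) + 2 * (ρ x * gradInner (laplacian Φ) Φ x) := by
    ext x
    rw [laplacian_gradInner_self hΦ]
    ring
  rw [this, torusIntegral_add ((hρ.1.mul hHess).const_mul 2)
    ((hρ.1.mul (hΦ.laplacian.gradInner hΦ)).const_mul 2), torusIntegral_const_mul,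
    torusIntegral_const_mul]
  ring

lemma wLap_eq_zero_of_hessianMetric (hρ : ρ ∈ densities d) (hΦ : IsTorusSmooth Φ)
    (h : hessianMetric entropy ρ (wLap ρ Φ) (wLap ρ Φ) ≤ 0) : wLap ρ Φ = 0 := by
  rw [hessianMetric_wLap_self hρ hΦ] at h
  have hnn : ∀ x, 0 ≤ ∑ i, ∑ j, pd j (pd i Φ) x ^ 2 := fun x => by positivity
  have hHess : IsTorusSmooth fun x => ∑ i, ∑ j, pd j (pd i Φ) x ^ 2 := by
    simp only [sq]
    exact .sum fun i _ => .sum fun j _ => ((hΦ.pd i).pd j).mul ((hΦ.pd i).pd j)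
  have hnn' : ∀ x, 0 ≤ ρ x * ∑ i, ∑ j, pd j (pd i Φ) x ^ 2 :=
    fun x => mul_nonneg (hρ.2.2 x).le (hnn x)
  have hz := (hρ.1.mul hHess).eq_zero hnn' (le_antisymm h (integral_nonneg hnn'))
  have hij : ∀ i j x, pd j (pd i Φ) x = 0 := fun i j x => by
    have h1 := (mul_eq_zero.1 (hz x)).resolve_left (hρ.2.2 x).ne'
    have h2 := (Finset.sum_eq_zero_iff_of_nonneg fun i _ => by positivity).1 h1 i
      (Finset.mem_univ i)
    have h3 := (Finset.sum_eq_zero_iff_of_nonneg fun j _ => by positivity).1 h2 j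
      (Finset.mem_univ j)
    exact pow_eq_zero_iff (two_ne_zero) |>.1 h3
  -- Compactness of the torus enters here: an affine function is periodic only if it is constant.
  have hi : ∀ i, pd i Φ = fun _ => 0 := fun i => by
    obtain ⟨c, hc⟩ := exists_eq_const_of_pd_eq_zero (hΦ.pd i) (hij i)
    have h0 := torusIntegral_pd hΦ i
    rw [hc, torusIntegral_const] at h0
    rw [hc, h0]
  ext x
  simp only [wLap, hi, mul_zero, pd_const, Finset.sum_const_zero, Pi.zero_apply]

lemma hessianMetric_pos (hρ : ρ ∈ densities d) (hσ : σ ∈ tangent d) (h0 : σ ≠ 0) :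
    0 < hessianMetric entropy ρ σ σ := by
  obtain ⟨Φ, hΦ, rfl⟩ := exists_wLap_eq hρ hσ
  exact not_le.1 fun h => h0 (wLap_eq_zero_of_hessianMetric hρ hΦ h)

lemma hessianIntegrand_sub_right (hρ : ρ ∈ densities d) (hΦ : IsTorusSmooth Φ)
    (hΨ : IsTorusSmooth Ψ) (Θ : (Fin d → ℝ) → ℝ) (x : Fin d → ℝ) :
    hessianIntegrand ρ Θ (fun y => Φ y - Ψ y) x
      = hessianIntegrand ρ Θ Φ x - hessianIntegrand ρ Θ Ψ x := by
  simp only [hessianIntegrand, wLap_sub hρ.1 hΦ hΨ, Pi.sub_apply, gradInner_sub_right hΦ hΨ]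
  ring

lemma IsGradient.pairing_eq
    {G : ((Fin d → ℝ) → ℝ) → ((Fin d → ℝ) → ℝ) → ((Fin d → ℝ) → ℝ) → ℝ}
    {F : ((Fin d → ℝ) → ℝ) → ℝ} (hτ : IsGradient G F ρ τ) (hf : IsFirstVariation F ρ f)
    (hσ : σ ∈ tangent d) : G ρ σ τ = torusIntegral fun x => f x * σ x := by
  obtain ⟨-, -, g, hg, hG⟩ := hτ
  rw [hG σ hσ]
  exact (hg.2 σ hσ).unique (hf.2 σ hσ)

lemma neg_laplacian_eq (hρ : ρ ∈ densities d) :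
    -laplacian ρ = wLap ρ (fun x => -Real.log (ρ x)) := by
  rw [wLap_neg, wLap_log hρ]

theorem isGradient_transportMetric_entropy_iff (hρ : ρ ∈ densities d) :
    IsGradient transportMetric entropy ρ τ ↔ τ = -laplacian ρ := by
  have hL := hρ.1.log fun x => (hρ.2.2 x).ne'
  have hvar := isFirstVariation_entropy hρ
  constructor
  · rintro h
    obtain ⟨-, ⟨Φ, hΦ, rfl⟩, -⟩ := id h
    obtain ⟨c, hc⟩ := exists_eq_add_const hΦ hvar.1 fun σ hσ => by
      rw [← h.pairing_eq hvar hσ, ← wLap_neg, transportMetric_wLap hρ hσ hΦ.neg,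
        ← torusIntegral_neg]
      simp
    rw [hc, wLap_add_const (hL.add (.const 1)), wLap_add_const hL, wLap_log hρ]
  · rintro rfl
    refine ⟨neg_mem_tangent (laplacian_mem_tangent hρ.1), ⟨_, hL, by rw [wLap_log hρ]⟩, _, hvar,
      fun σ hσ => ?_⟩
    rw [neg_laplacian_eq hρ, transportMetric_wLap hρ hσ hL.neg, ← torusIntegral_neg]
    have : (fun x => (Real.log (ρ x) + 1) * σ x) = fun x => Real.log (ρ x) * σ x + σ x := by
      ext x; ring
    rw [this, torusIntegral_add (hL.mul hσ.1) hσ.1, hσ.2]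
    simp

theorem halfFisher_eq_transportMetric (hρ : ρ ∈ densities d) :
    halfFisher ρ = 1 / 2 * transportMetric ρ (-laplacian ρ) (-laplacian ρ) := by
  have hL := hρ.1.log fun x => (hρ.2.2 x).ne'
  have hmem := neg_mem_tangent (laplacian_mem_tangent hρ.1)
  rw [halfFisher, neg_laplacian_eq hρ] at *
  rw [transportMetric_wLap hρ hmem hL.neg, torusIntegral_mul_wLap hL.neg hρ.1 hL.neg, neg_neg]
  congr 2
  ext x
  rw [gradInner_neg_right, gradInner_comm (fun x => -Real.log (ρ x)), gradInner_neg_right]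
  ring

/-- For Ψ = -log ρ the two terms containing ∇log ρ·∇Φ cancel, and Δρ/ρ = Δlog ρ + |∇log ρ|² makes
the integrands agree pointwise. -/
lemma isGradient_hessianMetric_neg_laplacian (hρ : ρ ∈ densities d) :
    IsGradient (hessianMetric entropy) halfFisher ρ (-laplacian ρ) := by
  have hL := hρ.1.log fun x => (hρ.2.2 x).ne'
  refine ⟨neg_mem_tangent (laplacian_mem_tangent hρ.1), ⟨_, hL, by rw [wLap_log hρ]⟩, _,
    isFirstVariation_halfFisher hρ, fun σ hσ => ?_⟩
  obtain ⟨Φ, hΦ, rfl⟩ := exists_wLap_eq hρ hσ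
  rw [neg_laplacian_eq hρ, hessianMetric_wLap hρ hΦ hL.neg]
  congr 1
  ext x
  have hx := (hρ.2.2 x).ne'
  have h1 : laplacian ρ x = ρ x * (laplacian (fun y => Real.log (ρ y)) x
      + gradInner (fun y => Real.log (ρ y)) (fun y => Real.log (ρ y)) x) := by
    rw [← wLap_log hρ, wLap_expand hρ.1 hL, mul_add, gradInner_log hρ]
  rw [hessianIntegrand, wLap_neg, wLap_log hρ, gradInner_neg_right, gradInner_neg_right,
    gradInner_comm Φ, Pi.neg_apply, mul_div_assoc, h1]
  field_simp
  ring

/-- Two gradients have the same pairings; testing against their difference, with potential -Φ + log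
ρ, and using linearity in the second slot, gives it zero Hessian norm. -/
theorem isGradient_hessianMetric_halfFisher_iff (hρ : ρ ∈ densities d) :
    IsGradient (hessianMetric entropy) halfFisher ρ τ ↔ τ = -laplacian ρ := by
  have hL := hρ.1.log fun x => (hρ.2.2 x).ne'
  refine ⟨fun h => ?_, fun h => h ▸ isGradient_hessianMetric_neg_laplacian hρ⟩
  obtain ⟨-, ⟨Φ, hΦ, rfl⟩, -⟩ := id h
  have hΘ := hΦ.neg.sub hL.neg
  have hpair := (h.pairing_eq (isFirstVariation_halfFisher hρ) (wLap_mem_tangent hρ.1 hΘ)).trans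
    ((isGradient_hessianMetric_neg_laplacian hρ).pairing_eq (isFirstVariation_halfFisher hρ)
      (wLap_mem_tangent hρ.1 hΘ)).symm
  rw [neg_laplacian_eq hρ, ← wLap_neg, hessianMetric_wLap hρ hΘ hΦ.neg,
    hessianMetric_wLap hρ hΘ hL.neg] at hpair
  have h0 := wLap_eq_zero_of_hessianMetric hρ hΘ (by
    rw [hessianMetric_wLap hρ hΘ hΘ, funext (hessianIntegrand_sub_right hρ hΦ.neg hL.neg _),
      torusIntegral_sub (isTorusSmooth_hessianIntegrand hρ hΘ hΦ.neg)
        (isTorusSmooth_hessianIntegrand hρ hΘ hL.neg), hpair, sub_self])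
  rw [wLap_sub hρ.1 hΦ.neg hL.neg, ← neg_laplacian_eq hρ, wLap_neg] at h0
  exact sub_eq_zero.1 h0

end Metric

end TransportHessian

open TransportHessian
theorem mainTheorem7 (d : ℕ) :
    (∀ ρ ∈ densities d,
      -- half the Fisher information is half the squared length of the transport gradient of entropy
      (∀ τ, IsGradient transportMetric entropy ρ τ ↔ τ = -laplacian ρ) ∧
      halfFisher ρ = 1 / 2 * transportMetric ρ (-laplacian ρ) (-laplacian ρ) ∧
      -- the transport Hessian metric of the entropy is positive definite
      (∀ σ ∈ tangent d, σ ≠ 0 → 0 < hessianMetric entropy ρ σ σ) ∧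
      -- the transport Hessian gradient of half the Fisher information
      (∀ τ, IsGradient (hessianMetric entropy) halfFisher ρ τ ↔ τ = -laplacian ρ)) ∧
    -- the transport Hessian gradient flow is the heat equation
    (∀ (I : Set ℝ) (ρ : ℝ → (Fin d → ℝ) → ℝ), (∀ t ∈ I, ρ t ∈ densities d) →
      (IsGradientFlow (hessianMetric entropy) halfFisher I ρ ↔
        ∀ t ∈ I, ∀ x, HasDerivWithinAt (fun s => ρ s x) (laplacian (ρ t) x) I t)) := by
  refine ⟨fun ρ hρ => ⟨fun τ => isGradient_transportMetric_entropy_iff hρ,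
    halfFisher_eq_transportMetric hρ, fun σ hσ h0 => hessianMetric_pos hρ hσ h0,
    fun τ => isGradient_hessianMetric_halfFisher_iff hρ⟩, fun I ρ hρ => ⟨fun h t ht x => ?_,
    fun h t ht => ⟨hρ t ht, _, isGradient_hessianMetric_neg_laplacian (hρ t ht), fun x => ?_⟩⟩⟩
  · obtain ⟨-, τ, hτ, hd⟩ := h t ht
    rw [isGradient_hessianMetric_halfFisher_iff (hρ t ht)] at hτ
    simpa [hτ] using hd x
  · simpa using h t ht x
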